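/- Two agents, $1$ and $2$, with budgets $B_1,B_2\ge 0$ and values $v_1,v_2$ per item, take part in a sequence of $k$ first-price sealed-bid auctions of identical items. Assume $v_i>2^kB_j$ for all $i,j\in\{1,2\}$. In each round each agent bids $b$ or $b+$ (infinitesimally more than $b$) for some $b\ge 0$ within her remaining budget. The higher bidder wins and pays $b$ out of her budget. If the bids are the same, the winner is drawn uniformly at random and pays $b$. The utility of an agent is her value for the items she wins plus her remaining budget. Write $-i$ for the rival of agent $i$. The canonical outcome, and the expected utility $U^{(k)}_i(B_i,B_{-i})$ of agent $i$ in it, are defined recursively, with $U^{(0)}_i(B_i,B_{-i})=B_i$. Suppose $k\ge 1$. - If $k=1$, or if $kB_i<B_{-i}$ for some $i$, then in the first round the agent with the smaller budget $b$ bids $b$ and the agent with the larger budget bids $b+$ (both bid $b$ if the budgets are equal). - Otherwise let $W_i(p)=v_i+U^{(k-1)}_i(B_i-p,B_{-i})$ and $L_i(p)=U^{(k-1)}_i(B_i,B_{-i}-p)$ for $0\le p\le\min(B_1,B_2)$. The critical price $p_i$ of agent $i$ is the price in $[0,\min(B_1,B_2)]$ such that $W_i(p)<L_i(p)$ for every $p>p_i$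 and $W_i(p)>L_i(p)$ for every $p<p_i$ in this interval. In the first round, if $p_i>p_{-i}$, then agent $i$ bids $p_{-i}+$ and agent $-i$ bids $p_{-i}$. If $p_1=p_2$, then both agents bid this price. After the first round both agents follow the canonical outcome for $k-1$ items with the remaining budgets. Then, if $k\ge 2$ and $kB_i\ge B_{-i}$ for both $i$, each agent has exactly one critical price, so that the canonical outcome is well defined. Moreover, the prices paid in the successive rounds of the canonical outcome are non-increasing from round to round, for every possible result of the random tie-breaking. -/

import Mathlib

namespace SeqAuction

/-- The two agents. The rival of agent `i` is `!i`. -/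
abbrev Agent := Bool

/-- A bid is either `b` (`plus = false`) or `b+` (`plus = true`), the latter being infinitesimally
larger than the former. -/
structure Bid where
  amount : ℝ
  plus : Bool

/-- `b.Beats c`: the bid `b` is strictly higher than the bid `c`. -/
def Bid.Beats (b c : Bid) : Prop :=
  c.amount < b.amount ∨ (c.amount = b.amount ∧ c.plus = false ∧ b.plus = true)

open Classical in
/-- The agents that can be awarded the item: the highest bidder, or both agents if they bid the
same (in that case the item goes to one of the two uniformly at random). -/
noncomputable def winners (b : Agent → Bid) : Finset Agent :=
  Finset.univ.filter fun i => ¬ (b (!i)).Beats (b i)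

/-- The budgets after agent `w` has paid `p`. -/
noncomputable def pay (B : Agent → ℝ) (w : Agent) (p : ℝ) : Agent → ℝ :=
  Function.update B w (B w - p)

/-- Utility of agent `i` for winning the current item at price `p`, where `u` gives the utilities
in the remaining auction as a function of the remaining budgets. -/
noncomputable def winningUtility (v : Agent → ℝ) (u : (Agent → ℝ) → Agent → ℝ)
    (B : Agent → ℝ) (i : Agent) (p : ℝ) : ℝ :=
  v i + u (pay B i p) i

/-- Utility of agent `i` if her rival wins the current item at price `p`. -/
noncomputable def losingUtility (u : (Agent → ℝ) → Agent → ℝ)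
    (B : Agent → ℝ) (i : Agent) (p : ℝ) : ℝ :=
  u (pay B (!i) p) i

/-- `p` is a critical price of agent `i`: among the prices that both agents can pay, agent `i`
strictly prefers losing at every higher price and strictly prefers winning at every lower one. -/
def IsCriticalPrice (v : Agent → ℝ) (u : (Agent → ℝ) → Agent → ℝ)
    (B : Agent → ℝ) (i : Agent) (p : ℝ) : Prop :=
  p ∈ Set.Icc 0 (min (B i) (B !i)) ∧
    (∀ q ∈ Set.Icc 0 (min (B i) (B !i)), p < q →
      winningUtility v u B i q < losingUtility u B i q) ∧
    (∀ q ∈ Set.Icc 0 (min (B i) (B !i)), q < p →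
      losingUtility u B i q < winningUtility v u B i q)

/-- The critical price of agent `i`. -/
noncomputable def criticalPrice (v : Agent → ℝ) (u : (Agent → ℝ) → Agent → ℝ)
    (B : Agent → ℝ) (i : Agent) : ℝ :=
  Classical.epsilon (IsCriticalPrice v u B i)

open Classical in
/-- Given thresholds `r`, the agent with the higher threshold bids `r+` for the lower threshold
`r`, and the other agent bids `r`. If the thresholds are equal, both bid them. -/
noncomputable def thresholdBids (r : Agent → ℝ) (i : Agent) : Bid :=
  if r (!i) < r i then ⟨r (!i), true⟩ else ⟨r i, false⟩

/-- With `k` items left, some agent is so poor that her rival can win all of them by paying the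
poor agent's budget for each and still has money left. -/
def Lopsided (k : ℕ) (B : Agent → ℝ) : Prop :=
  ∃ i, (k : ℝ) * B i < B (!i)

open Classical in
/-- The canonical bids in the current round when `k` items are left, where `u` gives the utilities
in the remaining auction of `k - 1` items. For a single item, and in the lopsided case (where an
agent need not have a critical price), the thresholds are the budgets: the poorer agent bids her
budget `b` and the richer one bids `b+`. Otherwise the thresholds are the critical prices. -/
noncomputable def canonicalBids (v : Agent → ℝ) (u : (Agent → ℝ) → Agent → ℝ)
    (k : ℕ) (B : Agent → ℝ) : Agent → Bid :=
  if k = 1 ∨ Lopsided k B then thresholdBids B else thresholdBids (criticalPrice v u B)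

/-- `utility v k B i`: expected utility (value of the items won plus remaining budget) of agent `i`
in the canonical outcome with `k` items and budgets `B`. -/
noncomputable def utility (v : Agent → ℝ) : ℕ → (Agent → ℝ) → Agent → ℝ
  | 0, B, i => B i
  | k + 1, B, i =>
      (∑ w ∈ winners (canonicalBids v (utility v k) (k + 1) B),
        if w = i then
          winningUtility v (utility v k) B i
            (canonicalBids v (utility v k) (k + 1) B w).amount
        else
          losingUtility (utility v k) B i
            (canonicalBids v (utility v k) (k + 1) B w).amount)
      / (winners (canonicalBids v (utility v k) (k + 1) B)).card

/-- `IsCanonicalPlay v k B l`: the list `l` of pairs (winner, price paid), in the order of the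
rounds, is a possible realization of the canonical outcome with `k` items and budgets `B`, that is,
it occurs for some results of the tie-breaking coins. -/
inductive IsCanonicalPlay (v : Agent → ℝ) : ℕ → (Agent → ℝ) → List (Agent × ℝ) → Prop
  | nil (B : Agent → ℝ) : IsCanonicalPlay v 0 B []
  | cons (k : ℕ) (B : Agent → ℝ) (w : Agent) (p : ℝ) (l : List (Agent × ℝ))
      (hw : w ∈ winners (canonicalBids v (utility v k) (k + 1) B))
      (hp : p = (canonicalBids v (utility v k) (k + 1) B w).amount)
      (hl : IsCanonicalPlay v k (pay B w p) l) :
      IsCanonicalPlay v (k + 1) B ((w, p) :: l)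

end SeqAuction

/-! ### The late winner's indifference recursion -/

namespace SeqAuction

/-! Since each value exceeds `2 ^ k` times every budget, money never outweighs an item that is won
with probability at least `2⁻ᵏ`. Utilities are therefore compared lexicographically, items first and
money second, and the canonical outcome can be computed explicitly.

For `k` items, the ratio of the two budgets either lies strictly between consecutive thresholds
`jumpRatio`, which fixes how many items each agent wins, or hits a threshold, in which case one item
is contested. Between thresholds, either one agent outbids the other in every round, or one agent
wins early and the other takes the last `n + 1` items at the price `z` that the early winner has
left. With remaining money `m` of the late winner, the rival's budget is `rivalBudget (a + 1) n x
m`. The recursion expresses indifference: losing at the critical price and winning at it lead to the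
same total number of items and the same money. On a threshold both critical prices coincide, and
each possible result of the coin leads to another threshold or to a trivial auction. The utility
then lies strictly between those of the two neighbouring outcomes.

This description (`utilityDescribed`) is proved by induction on `k`. Items and money improve with
the own budget and do not improve with the rival's budget (`Outcome.lt_of_budget_lt`,
`Outcome.le_of_rival_le`). Hence the winning utility strictly decreases in the price and the losing
utility does not decrease, which gives unique critical prices. The late winner's is `latePrice`, and
the early winner's is at least that.

Monotonicity of the prices is discrete convexity of `rivalBudget` in the number of early items
(`latePrice_le_latePrice_succ`). Its case `x = m` is convexity of the thresholds
(`jumpRatio_convex`) and settles contested rounds. A tie off the thresholds forces the current price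
to be `z` already (`UtilityDescribed.eq_of_isCriticalPrice_latePrice`), and the price then stays
there. -/

/-- `rivalBudget a n x m` is the largest budget of the rival against which an agent with budget `x`
who lets the rival win the first `a` items can secure the last `n + 1` items and the remaining
budget `m`. -/
noncomputable def rivalBudget : ℕ → ℕ → ℝ → ℝ → ℝ
  | 0, n, x, m => max (x - m) 0 / (n + 1)
  -- Winning her only item at `p` leaves her either with the money `m`, so `p = x - m`, or at the
  -- contested ratio, where the rival's budget is `(a + 1) * (x - p)`. The larger price counts.
  | a + 1, 0, x, m =>
      max (x - m + rivalBudget a 0 x m) ((a + 1) / (a + 2) * (x + rivalBudget a 0 x m))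
  -- Indifference at `p`: the left side is the rival's budget if losing preserves `m`, the right
  -- side is that budget if winning does.
  | a + 1, n + 1, x, m =>
      rivalBudget a (n + 1) x m +
        Classical.epsilon fun p : ℝ =>
          p + rivalBudget a (n + 1) x m = rivalBudget (a + 1) n (x - p) m
termination_by a n => (a, n)

/-- The price at which an agent with budget `x` is indifferent between winning and losing when she
expects `n + 1` items and the remaining budget `m`, and her rival expects `a + 1` items. -/
noncomputable def latePrice (a n : ℕ) (x m : ℝ) : ℝ :=
  rivalBudget (a + 1) n x m - rivalBudget a n x m

theorem rivalBudget_zero (n : ℕ) (x m : ℝ) :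
    rivalBudget 0 n x m = max (x - m) 0 / (n + 1) := by
  rw [rivalBudget]

theorem rivalBudget_succ_zero (a : ℕ) (x m : ℝ) :
    rivalBudget (a + 1) 0 x m =
      max (x - m + rivalBudget a 0 x m) ((a + 1) / (a + 2) * (x + rivalBudget a 0 x m)) := by
  rw [rivalBudget]

theorem rivalBudget_succ_eq (a n : ℕ) (x m : ℝ) :
    rivalBudget (a + 1) n x m = rivalBudget a n x m + latePrice a n x m := by
  rw [latePrice]; ring

theorem latePrice_zero (a : ℕ) (x m : ℝ) :
    latePrice a 0 x m = max (x - m) (((a + 1) * x - rivalBudget a 0 x m) / (a + 2)) := by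
  have h : (0 : ℝ) < a + 2 := by positivity
  rw [latePrice, rivalBudget_succ_zero, ← max_sub_sub_right]
  congr 1
  · ring
  · field_simp
    ring

/-- A strictly increasing indifference equation has a solution. -/
theorem exists_add_eq_of_continuous_monotone {g : ℝ → ℝ} (hg : Continuous g) (hm : Monotone g)
    (A x : ℝ) : ∃ p, p + A = g (x - p) := by
  have hc : Continuous fun p => p + A - g (x - p) := by fun_prop
  have h1 : (fun p => p + A - g (x - p)) (min 0 (g x - A)) ≤ 0 := by
    have := hm (show x ≤ x - min 0 (g x - A) by linarith [min_le_left 0 (g x - A)])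
    have := min_le_right 0 (g x - A)
    simp only; linarith
  have h2 : 0 ≤ (fun p => p + A - g (x - p)) (max 0 (g x - A)) := by
    have := hm (show x - max 0 (g x - A) ≤ x by linarith [le_max_left 0 (g x - A)])
    have := le_max_right 0 (g x - A)
    simp only; linarith
  obtain ⟨p, hp⟩ := mem_range_of_exists_le_of_exists_ge hc ⟨_, h1⟩ ⟨_, h2⟩
  exact ⟨p, by simp only at hp; linarith⟩

theorem latePrice_succ_of {a n : ℕ} {m : ℝ}
    (hc : Continuous fun x => rivalBudget (a + 1) n x m)
    (hm : Monotone fun x => rivalBudget (a + 1) n x m) (x : ℝ) :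
    latePrice a (n + 1) x m + rivalBudget a (n + 1) x m =
      rivalBudget (a + 1) n (x - latePrice a (n + 1) x m) m := by
  have h := Classical.epsilon_spec
    (exists_add_eq_of_continuous_monotone hc hm (rivalBudget a (n + 1) x m) x)
  have e : latePrice a (n + 1) x m = Classical.epsilon fun p : ℝ =>
      p + rivalBudget a (n + 1) x m = rivalBudget (a + 1) n (x - p) m := by
    rw [latePrice, rivalBudget]; ring
  rw [e]; exact h

/-- Continuity and monotonicity go through one induction because the indifference equation is known
to be solvable only when both hold at the previous stage. -/
theorem rivalBudget_continuous_and_monotone (a n : ℕ) :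
    (Continuous fun q : ℝ × ℝ => rivalBudget a n q.1 q.2) ∧
      ∀ m, Monotone fun x => rivalBudget a n x m := by
  induction a generalizing n with
  | zero =>
    simp only [rivalBudget_zero]
    refine ⟨by fun_prop, fun m x y h => ?_⟩
    simp only
    gcongr
  | succ a iha =>
    induction n with
    | zero =>
      obtain ⟨h1, h2⟩ := iha 0
      simp only [rivalBudget_succ_zero]
      refine ⟨by fun_prop, fun m x y h => ?_⟩
      have := h2 m h
      simp only at this ⊢
      gcongr
    | succ n ihn =>
      obtain ⟨h1, h2⟩ := iha (n + 1)
      obtain ⟨h3, h4⟩ := ihn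
      have spec : ∀ x m, latePrice a (n + 1) x m + rivalBudget a (n + 1) x m =
          rivalBudget (a + 1) n (x - latePrice a (n + 1) x m) m := fun x m =>
        latePrice_succ_of (h3.comp (by fun_prop : Continuous fun x : ℝ => (x, m))) (h4 m) x
      constructor
      · simp only [rivalBudget_succ_eq a (n + 1)]
        refine h1.add ?_
        have hE : ∀ c, Continuous fun q : ℝ × ℝ =>
            c + rivalBudget a (n + 1) q.1 q.2 - rivalBudget (a + 1) n (q.1 - c) q.2 := fun c =>
          (continuous_const.add h1).sub
            (h3.comp (by fun_prop : Continuous fun q : ℝ × ℝ => (q.1 - c, q.2)))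
        -- The defect of the indifference equation is strictly increasing in the price, so comparing
        -- `latePrice` with `c` amounts to the sign of the defect at `c`, which is an open
        -- condition.
        rw [continuous_iff_lower_upperSemicontinuous]
        constructor
        · rw [lowerSemicontinuous_iff_isOpen_preimage]
          intro c
          convert isOpen_lt (hE c) (continuous_const (y := (0 : ℝ))) using 1
          ext ⟨x, m⟩
          have e := spec x m
          simp only [Set.mem_preimage, Set.mem_Ioi, Set.mem_ofPred_eq]
          constructor <;> intro h
          · have := h4 m (show x - latePrice a (n + 1) x m ≤ x - c by linarith)
            simp only at this; linarith
          · by_contra! hlt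
            have := h4 m (show x - c ≤ x - latePrice a (n + 1) x m by linarith)
            simp only at this; linarith
        · rw [upperSemicontinuous_iff_isOpen_preimage]
          intro c
          convert isOpen_lt (continuous_const (y := (0 : ℝ))) (hE c) using 1
          ext ⟨x, m⟩
          have e := spec x m
          simp only [Set.mem_preimage, Set.mem_Iio, Set.mem_ofPred_eq]
          constructor <;> intro h
          · have := h4 m (show x - c ≤ x - latePrice a (n + 1) x m by linarith)
            simp only at this; linarith
          · by_contra! hlt
            have := h4 m (show x - latePrice a (n + 1) x m ≤ x - c by linarith)
            simp only at this; linarith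
      · intro m x y h
        simp only
        -- If the value dropped, so would the price. More budget would then remain after winning,
        -- and the value, which is the previous stage at that remainder, would rise.
        by_contra! hlt
        have e1 := spec x m
        have e2 := spec y m
        have e3 := rivalBudget_succ_eq a (n + 1) x m
        have e4 := rivalBudget_succ_eq a (n + 1) y m
        have e5 := h2 m h
        have e6 := h4 m (show x - latePrice a (n + 1) x m ≤ y - latePrice a (n + 1) y m by
          simp only at e5; linarith)
        simp only at e6; linarith

theorem rivalBudget_continuous (a n : ℕ) :
    Continuous fun q : ℝ × ℝ => rivalBudget a n q.1 q.2 :=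
  (rivalBudget_continuous_and_monotone a n).1

theorem rivalBudget_mono (a n : ℕ) {x y : ℝ} (m : ℝ) (h : x ≤ y) :
    rivalBudget a n x m ≤ rivalBudget a n y m :=
  (rivalBudget_continuous_and_monotone a n).2 m h

theorem latePrice_add_rivalBudget (a n : ℕ) (x m : ℝ) :
    latePrice a (n + 1) x m + rivalBudget a (n + 1) x m =
      rivalBudget (a + 1) n (x - latePrice a (n + 1) x m) m :=
  latePrice_succ_of
    ((rivalBudget_continuous (a + 1) n).comp (by fun_prop : Continuous fun x : ℝ => (x, m)))
    (fun _ _ h => rivalBudget_mono (a + 1) n m h) x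

theorem rivalBudget_succ_succ (a n : ℕ) (x m : ℝ) :
    rivalBudget (a + 1) (n + 1) x m =
      rivalBudget (a + 1) n (x - latePrice a (n + 1) x m) m := by
  rw [← latePrice_add_rivalBudget, rivalBudget_succ_eq]; ring

theorem le_latePrice_succ_iff {a n : ℕ} {x m p : ℝ} :
    p ≤ latePrice a (n + 1) x m ↔
      p + rivalBudget a (n + 1) x m ≤ rivalBudget (a + 1) n (x - p) m := by
  have e := latePrice_add_rivalBudget a n x m
  constructor <;> intro h
  · have := rivalBudget_mono (a + 1) n m (show x - latePrice a (n + 1) x m ≤ x - p by linarith)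
    linarith
  · by_contra! hlt
    have := rivalBudget_mono (a + 1) n m (show x - p ≤ x - latePrice a (n + 1) x m by linarith)
    linarith

theorem le_latePrice_zero_iff {a : ℕ} {x m p : ℝ} :
    p ≤ latePrice a 0 x m ↔ p ≤ x - m ∨ p + rivalBudget a 0 x m ≤ (a + 1) * (x - p) := by
  have h : (0 : ℝ) < a + 2 := by positivity
  rw [latePrice_zero, le_max_iff, le_div_iff₀ h]
  constructor <;> rintro (h | h)
  · exact Or.inl h
  · right; linarith
  · exact Or.inl h
  · right; linarith

theorem rivalBudget_strictMono (a n : ℕ) {x y : ℝ} (m : ℝ) (h : x < y) :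
    rivalBudget (a + 1) n x m < rivalBudget (a + 1) n y m := by
  induction n generalizing x y with
  | zero =>
    have h1 := rivalBudget_mono a 0 m h.le
    rw [rivalBudget_succ_zero, rivalBudget_succ_zero]
    apply max_lt_max
    · linarith
    · have : (0 : ℝ) < (a + 1) / (a + 2) := by positivity
      exact mul_lt_mul_of_pos_left (by linarith) this
  | succ n ih =>
    by_contra! hlt
    have h1 := rivalBudget_mono a (n + 1) m h.le
    have e3 := rivalBudget_succ_eq a (n + 1) x m
    have e4 := rivalBudget_succ_eq a (n + 1) y m
    have h2 := ih (show x - latePrice a (n + 1) x m < y - latePrice a (n + 1) y m by linarith)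
    rw [← rivalBudget_succ_succ, ← rivalBudget_succ_succ] at h2
    linarith

theorem rivalBudget_anti (a n : ℕ) (x : ℝ) {m m' : ℝ} (h : m ≤ m') :
    rivalBudget a n x m' ≤ rivalBudget a n x m := by
  induction a generalizing n x with
  | zero =>
    simp only [rivalBudget_zero]
    gcongr
  | succ a iha =>
    induction n generalizing x with
    | zero =>
      have := iha 0 x
      simp only [rivalBudget_succ_zero]
      gcongr
    | succ n ihn =>
      by_contra! hlt
      have h1 := iha (n + 1) x
      have e3 := rivalBudget_succ_eq a (n + 1) x m
      have e4 := rivalBudget_succ_eq a (n + 1) x m'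
      have h2 := ihn (x - latePrice a (n + 1) x m')
      have h3 := rivalBudget_mono (a + 1) n m
        (show x - latePrice a (n + 1) x m' ≤ x - latePrice a (n + 1) x m by linarith)
      rw [← rivalBudget_succ_succ] at h2 h3
      linarith

theorem rivalBudget_strictAnti (a n : ℕ) {x m m' : ℝ} (h : m < m') (hx : m < x) :
    rivalBudget a n x m' < rivalBudget a n x m := by
  induction a generalizing n with
  | zero =>
    simp only [rivalBudget_zero]
    gcongr
    rw [max_lt_iff, lt_max_iff, lt_max_iff]
    exact ⟨Or.inl (by linarith), Or.inl (by linarith)⟩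
  | succ a iha =>
    cases n with
    | zero =>
      have := iha 0
      simp only [rivalBudget_succ_zero]
      apply max_lt_max
      · linarith
      · have : (0 : ℝ) < (a + 1) / (a + 2) := by positivity
        gcongr
    | succ n =>
      by_contra! hlt
      have h1 := iha (n + 1)
      have e3 := rivalBudget_succ_eq a (n + 1) x m
      have e4 := rivalBudget_succ_eq a (n + 1) x m'
      have h2 := rivalBudget_anti (a + 1) n (x - latePrice a (n + 1) x m') h.le
      have h3 := rivalBudget_strictMono a n m
        (show x - latePrice a (n + 1) x m' < x - latePrice a (n + 1) x m by linarith)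
      rw [← rivalBudget_succ_succ] at h2 h3
      linarith

/-- Extra money that is merely kept does not weaken the agent. This compares two early winners with
different budgets. -/
theorem rivalBudget_le_shift (a n : ℕ) (x m : ℝ) {e : ℝ} (he : 0 ≤ e) :
    rivalBudget a n x m ≤ rivalBudget a n (x + e) (m + e) := by
  induction a generalizing n x with
  | zero =>
    simp only [rivalBudget_zero]
    apply le_of_eq; congr 2; ring
  | succ a iha =>
    induction n generalizing x with
    | zero =>
      have := iha 0 x
      simp only [rivalBudget_succ_zero]
      gcongr max ?_ ?_
      · linarith
      · gcongr
        linarith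
    | succ n ihn =>
      by_contra! hlt
      have h1 := iha (n + 1) x
      have e3 := rivalBudget_succ_eq a (n + 1) x m
      have e4 := rivalBudget_succ_eq a (n + 1) (x + e) (m + e)
      have h2 := ihn (x - latePrice a (n + 1) x m)
      have h3 := rivalBudget_mono (a + 1) n (m + e)
        (show x - latePrice a (n + 1) x m + e ≤ x + e - latePrice a (n + 1) (x + e) (m + e)
          by linarith)
      rw [← rivalBudget_succ_succ] at h2 h3
      linarith

/-! ### Budget ratios at which an item is contested -/

/-- The ratio of the rival's budget to the own one at which an agent is about to win `n + 1`
instead of `n` items, the other items (`a + n` items altogether) going to the rival. -/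
noncomputable def jumpRatio : ℕ → ℕ → ℝ
  | 0, _ => 0
  | a + 1, 0 => a + 1
  -- With `x = 1` and rival budget `y`, eliminate `p` from `y - p = jumpRatio a (n + 1)` and `y =
  -- jumpRatio (a + 1) n * (1 - p)`: both results of the round are again thresholds.
  | a + 1, n + 1 =>
      (1 + jumpRatio a (n + 1)) * jumpRatio (a + 1) n / (1 + jumpRatio (a + 1) n)
termination_by a n => (a, n)

theorem jumpRatio_zero_left (n : ℕ) : jumpRatio 0 n = 0 := by rw [jumpRatio]

theorem jumpRatio_zero_right (a : ℕ) : jumpRatio a 0 = a := by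
  cases a <;> rw [jumpRatio] <;> simp

theorem jumpRatio_succ_succ (a n : ℕ) : jumpRatio (a + 1) (n + 1) =
    (1 + jumpRatio a (n + 1)) * jumpRatio (a + 1) n / (1 + jumpRatio (a + 1) n) := by
  rw [jumpRatio]

theorem jumpRatio_nonneg (a n : ℕ) : 0 ≤ jumpRatio a n := by
  induction a generalizing n with
  | zero => rw [jumpRatio_zero_left]
  | succ a iha =>
    induction n with
    | zero => rw [jumpRatio_zero_right]; positivity
    | succ n ihn => have := iha (n + 1); rw [jumpRatio_succ_succ]; positivity

theorem jumpRatio_pos (a n : ℕ) : 0 < jumpRatio (a + 1) n := by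
  induction n with
  | zero => rw [jumpRatio_zero_right]; positivity
  | succ n ihn => have := jumpRatio_nonneg a (n + 1); rw [jumpRatio_succ_succ]; positivity

theorem jumpRatio_recurrence (a n : ℕ) : jumpRatio (a + 1) (n + 1) * (1 + jumpRatio (a + 1) n) =
    (1 + jumpRatio a (n + 1)) * jumpRatio (a + 1) n := by
  have := jumpRatio_pos a n
  rw [jumpRatio_succ_succ]; field_simp

/-- A threshold is the same for both agents, so exchanging their roles inverts the ratio. -/
theorem jumpRatio_dual (a n : ℕ) : jumpRatio (a + 1) n * jumpRatio (n + 1) a = 1 := by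
  induction a generalizing n with
  | zero =>
    induction n with
    | zero => simp [jumpRatio_zero_right]
    | succ n ihn =>
      rw [jumpRatio_zero_right, jumpRatio_succ_succ, jumpRatio_zero_left]
      rw [jumpRatio_zero_right] at ihn
      have := jumpRatio_pos 0 n
      push_cast at *
      field_simp
      linarith
  | succ a iha =>
    induction n with
    | zero =>
      have h := iha 0
      rw [jumpRatio_zero_right] at h ⊢
      rw [jumpRatio_succ_succ, jumpRatio_zero_left]
      have := jumpRatio_pos 0 a
      push_cast at *
      field_simp
      linarith
    | succ n ihn =>
      have h := iha (n + 1)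
      rw [jumpRatio_succ_succ (a + 1) n, jumpRatio_succ_succ (n + 1) a]
      have := jumpRatio_pos a (n + 1)
      have := jumpRatio_pos (a + 1) n
      have := jumpRatio_pos (n + 1) a
      have := jumpRatio_pos n (a + 1)
      field_simp
      nlinarith

theorem jumpRatio_anti (a n : ℕ) : jumpRatio a (n + 1) ≤ jumpRatio (a + 1) n := by
  induction a generalizing n with
  | zero => rw [jumpRatio_zero_left]; exact jumpRatio_nonneg _ _
  | succ a iha =>
    induction n with
    | zero =>
      have := iha 0
      have h2 := jumpRatio_recurrence a 0
      have h3 := jumpRatio_pos a 1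
      simp only [jumpRatio_zero_right, zero_add] at *
      push_cast at *
      have h4 : jumpRatio (a + 1) 1 * (1 + (a + 1)) ≤ (a + 1 + 1) * (1 + (a + 1)) := by
        rw [h2]; nlinarith
      exact le_of_mul_le_mul_right h4 (by positivity)
    | succ n ihn =>
      have h1 := iha (n + 1)
      have h2 := jumpRatio_recurrence a (n + 1)
      have h3 := jumpRatio_recurrence (a + 1) n
      have h4 := jumpRatio_pos a (n + 1)
      have h5 := jumpRatio_pos (a + 1) n
      rw [jumpRatio_succ_succ (a + 1) n, le_div_iff₀ (by positivity)]
      have h6 : jumpRatio (a + 1) (n + 1 + 1) ≤ jumpRatio (a + 1) (n + 1) := by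
        have : jumpRatio (a + 1) (n + 1 + 1) * (1 + jumpRatio (a + 1) (n + 1)) ≤
            jumpRatio (a + 1) (n + 1) * (1 + jumpRatio (a + 1) (n + 1)) := by
          rw [h2]; nlinarith
        exact le_of_mul_le_mul_right this (by positivity)
      nlinarith [jumpRatio_pos (a + 1) n]

theorem jumpRatio_le (a n : ℕ) : jumpRatio a n ≤ a + n := by
  induction n generalizing a with
  | zero => rw [jumpRatio_zero_right]; simp
  | succ n ih =>
    have := (jumpRatio_anti a n).trans (ih (a + 1))
    push_cast at *
    linarith

/-- Once `m` is at least the whole budget it no longer matters, and the recursion becomes the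
homogeneous one of `jumpRatio`. -/
theorem rivalBudget_of_le (a n : ℕ) {x m : ℝ} (hx : 0 ≤ x) (h : x ≤ m) :
    rivalBudget a n x m = jumpRatio a (n + 1) * x := by
  induction a generalizing n x with
  | zero =>
    rw [rivalBudget_zero, jumpRatio_zero_left, max_eq_right (by linarith)]; simp
  | succ a iha =>
    induction n generalizing x with
    | zero =>
      rw [rivalBudget_succ_zero, iha 0 hx h, jumpRatio_succ_succ, jumpRatio_zero_right]
      have h2 := jumpRatio_anti a 0
      rw [jumpRatio_zero_right] at h2
      push_cast at h2 ⊢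
      rw [max_eq_right]
      · field_simp
        ring
      · rw [div_mul_eq_mul_div, le_div_iff₀ (by positivity)]
        nlinarith [mul_le_mul_of_nonneg_right h2 hx]
    | succ n ihn =>
      have hA := iha (n + 1) hx h
      have hpos := jumpRatio_pos a (n + 1)
      have hr := jumpRatio_recurrence a (n + 1)
      have ha := jumpRatio_anti a (n + 1)
      set q := (jumpRatio (a + 1) (n + 1 + 1) - jumpRatio a (n + 1 + 1)) * x with hq
      have hxq : (x - q) * (1 + jumpRatio (a + 1) (n + 1)) = (1 + jumpRatio a (n + 1 + 1)) * x := by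
        rw [hq]; linear_combination (-x) * hr
      have hxq0 : 0 ≤ x - q := by
        have := jumpRatio_nonneg a (n + 1 + 1)
        by_contra! hneg
        have : (x - q) * (1 + jumpRatio (a + 1) (n + 1)) < 0 :=
          mul_neg_of_neg_of_pos hneg (by positivity)
        have : 0 ≤ (1 + jumpRatio a (n + 1 + 1)) * x := by positivity
        linarith
      have hq0 : 0 ≤ q := by
        by_contra! hneg
        nlinarith [mul_le_mul_of_nonneg_right ha hx]
      have hg : rivalBudget (a + 1) n (x - q) m = q + rivalBudget a (n + 1) x m := by
        rw [ihn hxq0 (by linarith), hA, hq]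
        linear_combination (-x) * hr
      have h1 := le_latePrice_succ_iff.2 hg.ge
      have h2 : latePrice a (n + 1) x m ≤ q := by
        by_contra! hlt
        have e := latePrice_add_rivalBudget a n x m
        have := rivalBudget_mono (a + 1) n m
          (show x - latePrice a (n + 1) x m ≤ x - q by linarith)
        linarith
      rw [rivalBudget_succ_eq, hA, le_antisymm h2 h1, hq]
      ring

theorem latePrice_self (a n : ℕ) {x : ℝ} (hx : 0 ≤ x) :
    latePrice a n x x = (jumpRatio (a + 1) (n + 1) - jumpRatio a (n + 1)) * x := by
  rw [latePrice, rivalBudget_of_le _ _ hx le_rfl, rivalBudget_of_le _ _ hx le_rfl]; ring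

theorem half_mul_le_rivalBudget (a : ℕ) (x m : ℝ) : a / 2 * x ≤ rivalBudget a 0 x m := by
  induction a with
  | zero => rw [rivalBudget_zero]; simp
  | succ a ih =>
    rw [rivalBudget_succ_zero]
    refine le_trans ?_ (le_max_right _ _)
    have h : (0 : ℝ) < a + 2 := by positivity
    rw [div_mul_eq_mul_div _ _ (x + _), le_div_iff₀ h]
    push_cast
    nlinarith

/-- The balanced case, where every price is `m`. It is the borderline between the two possible late
winners. -/
theorem rivalBudget_of_eq_mul (a n : ℕ) {m : ℝ} (hm : 0 ≤ m) :
    rivalBudget a n ((n + 2) * m) m = (a + 1) * m := by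
  induction a generalizing n with
  | zero =>
    rw [rivalBudget_zero, max_eq_left (by nlinarith)]
    field_simp
    push_cast; ring
  | succ a iha =>
    induction n with
    | zero =>
      have := iha 0
      push_cast at *
      rw [rivalBudget_succ_zero, this, max_eq_left]
      · ring
      · rw [div_mul_eq_mul_div, div_le_iff₀ (by positivity)]
        nlinarith
    | succ n ihn =>
      have h := iha (n + 1)
      push_cast at *
      have e : (n + 1 + 2) * m - m = (n + 2) * m := by ring
      have hg : rivalBudget (a + 1) n ((n + 1 + 2) * m - m) m =
          m + rivalBudget a (n + 1) ((n + 1 + 2) * m) m := by rw [e, ihn, h]; ring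
      have h1 := le_latePrice_succ_iff.2 hg.ge
      have h2 : latePrice a (n + 1) ((n + 1 + 2) * m) m ≤ m := by
        by_contra! hlt
        have e := latePrice_add_rivalBudget a n ((n + 1 + 2) * m) m
        have := rivalBudget_mono (a + 1) n m
          (show (n + 1 + 2) * m - latePrice a (n + 1) ((n + 1 + 2) * m) m ≤
            (n + 1 + 2) * m - m by linarith)
        linarith
      rw [rivalBudget_succ_eq, h, le_antisymm h2 h1]
      ring

/-! ### Monotonicity of the indifference prices -/

theorem rivalBudget_zero_add (n : ℕ) (m : ℝ) {z : ℝ} (hz : 0 ≤ z) :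
    rivalBudget 0 n (m + (n + 1) * z) m = z := by
  rw [rivalBudget_zero, max_eq_left (by nlinarith)]
  field_simp
  ring

/-- The price is at least what the agent pays per item in the end. -/
theorem le_latePrice (a n : ℕ) (m : ℝ) {z : ℝ} (hz : 0 ≤ z) :
    z ≤ latePrice a n (m + (n + 1) * z) m := by
  induction n generalizing a with
  | zero => rw [le_latePrice_zero_iff]; left; push_cast; linarith
  | succ n ihn =>
    induction a with
    | zero =>
      rw [le_latePrice_succ_iff, rivalBudget_zero_add _ _ hz, rivalBudget_succ_eq]
      have h := ihn 0
      have e : m + ((n + 1 : ℕ) + 1) * z - z = m + (n + 1) * z := by push_cast; ring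
      rw [e, rivalBudget_zero_add _ _ hz]
      linarith
    | succ a iha =>
      have e : m + ((n + 1 : ℕ) + 1) * z - z = m + (n + 1) * z := by push_cast; ring
      rw [le_latePrice_succ_iff, rivalBudget_succ_succ, e, rivalBudget_succ_eq (a + 1) n]
      have h := ihn (a + 1)
      have h2 := rivalBudget_mono (a + 1) n m (show m + ((n + 1 : ℕ) + 1) * z -
        latePrice a (n + 1) (m + ((n + 1 : ℕ) + 1) * z) m ≤ m + (n + 1) * z by linarith)
      linarith

theorem rivalBudget_succ_right_le (a n : ℕ) (m : ℝ) {z : ℝ} (hz : 0 ≤ z) :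
    rivalBudget a (n + 1) (m + (n + 2) * z) m ≤ rivalBudget a n (m + (n + 1) * z) m := by
  cases a with
  | zero =>
    have h := rivalBudget_zero_add (n + 1) m hz
    rw [rivalBudget_zero_add _ _ hz]
    push_cast at h
    rw [show m + ((n : ℝ) + 2) * z = m + (n + 1 + 1) * z by ring, h]
  | succ a =>
    have h := le_latePrice a (n + 1) m hz
    push_cast at h
    rw [show (n : ℝ) + 1 + 1 = n + 2 by ring] at h
    rw [rivalBudget_succ_succ]
    exact rivalBudget_mono _ _ _ (by linarith)

theorem mul_le_rivalBudget (a n : ℕ) (m : ℝ) {z : ℝ} (hz : 0 ≤ z) :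
    (a + 1) * z ≤ rivalBudget a n (m + (n + 1) * z) m := by
  induction a with
  | zero => rw [rivalBudget_zero_add _ _ hz]; simp
  | succ a ih =>
    rw [rivalBudget_succ_eq]
    have := le_latePrice a n m hz
    push_cast; linarith

/-- If the price is what the agent pays per item in the end, then this remains so after she has
won an item. -/
theorem latePrice_eq_of_latePrice_succ_eq {a n : ℕ} {m z : ℝ} (hz : 0 ≤ z)
    (h : latePrice a (n + 1) (m + (n + 2) * z) m = z) :
    latePrice a n (m + (n + 1) * z) m = z := by
  have e := latePrice_add_rivalBudget a n (m + (n + 2) * z) m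
  rw [h, show m + ((n : ℝ) + 2) * z - z = m + (n + 1) * z by ring] at e
  have h1 := rivalBudget_succ_right_le a n m hz
  have h2 := le_latePrice a n m hz
  rw [latePrice] at h2 ⊢
  linarith

/-- The bound `p ≤ x - p - m` does not involve `a`. In the other alternative,
`half_mul_le_rivalBudget` forces `3 * p ≤ x`, which is enough slack for one more early item. -/
theorem le_latePrice_zero_of_le {a : ℕ} {x m p : ℝ} (h : p ≤ latePrice a 0 (x - p) m) :
    p ≤ latePrice (a + 1) 0 (x - p) m := by
  rw [le_latePrice_zero_iff] at h ⊢
  rcases h with h | h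
  · exact Or.inl h
  by_cases hm : p ≤ x - p - m
  · exact Or.inl hm
  right
  have h2 := half_mul_le_rivalBudget a (x - p) m
  have h3 : (a + 2) * (3 * p) ≤ (a + 2) * x := by linarith
  have h4 := le_of_mul_le_mul_left h3 (by positivity)
  have h5 : rivalBudget (a + 1) 0 (x - p) m ≤ (a + 1) * (x - p - p) := by
    rw [rivalBudget_succ_zero]
    apply max_le
    · linarith
    · rw [div_mul_eq_mul_div, div_le_iff₀ (by positivity)]
      nlinarith
  push_cast
  linarith

theorem le_latePrice_succ_of_le {a n : ℕ} {x m p : ℝ}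
    (h : p ≤ latePrice a (n + 1) (x - p) m) (h' : p ≤ latePrice (a + 1) n (x - p - p) m) :
    p ≤ latePrice (a + 1) (n + 1) (x - p) m := by
  rw [le_latePrice_succ_iff]
  have h1 := rivalBudget_succ_succ a n (x - p) m
  have h2 := rivalBudget_mono (a + 1) n m
    (show x - p - latePrice a (n + 1) (x - p) m ≤ x - p - p by linarith)
  have h3 := rivalBudget_succ_eq (a + 1) n (x - p - p) m
  linarith

theorem le_latePrice_zero_sub {n : ℕ} {x m p : ℝ} (h : p ≤ latePrice 0 (n + 1) x m) :
    p ≤ latePrice 0 n (x - p) m := by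
  by_contra! hp
  rw [le_latePrice_succ_iff, rivalBudget_succ_eq 0 n] at h
  have h0 : rivalBudget 0 (n + 1) x m < rivalBudget 0 n (x - p) m := by linarith
  rw [rivalBudget_zero, rivalBudget_zero] at h0
  have h1 : 0 < x - p - m := by
    by_contra! hneg
    rw [max_eq_right hneg, zero_div] at h0
    exact absurd h0 (not_lt.2 (by positivity))
  rw [max_eq_left h1.le] at h0
  set z := (x - p - m) / (n + 1) with hz
  have hz0 : 0 ≤ z := by positivity
  have hxz : x - p - m = (n + 1) * z := by rw [hz]; field_simp
  have h2 := le_latePrice 0 n m hz0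
  rw [show m + ((n : ℝ) + 1) * z = x - p by linarith] at h2
  have h3 : (x - m) / ((n + 1 : ℕ) + 1) < z := lt_of_le_of_lt (by gcongr; exact le_max_left _ _) h0
  rw [div_lt_iff₀ (by positivity)] at h3
  push_cast at h3
  nlinarith

/-- A price at which an agent would like to win remains so after she has won an item at it. -/
theorem le_latePrice_of_le_latePrice_succ (a n : ℕ) {x m p : ℝ}
    (h : p ≤ latePrice a (n + 1) x m) : p ≤ latePrice (a + 1) n (x - p) m := by
  induction a generalizing n x with
  | zero =>
    induction n generalizing x with
    | zero => exact le_latePrice_zero_of_le (le_latePrice_zero_sub h)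
    | succ n ihn =>
      exact le_latePrice_succ_of_le (le_latePrice_zero_sub h) (ihn (le_latePrice_zero_sub h))
  | succ a iha =>
    -- A weaker claim first, with the number of early items unchanged. If it failed, comparing rival
    -- budgets would give `p ≤ latePrice a (n + 1) x m`, and the induction hypothesis on `a`
    -- applies.
    have key : ∀ n x, p ≤ latePrice (a + 1) (n + 1) x m → p ≤ latePrice (a + 1) n (x - p) m := by
      intro n x h
      by_contra! hp
      rw [le_latePrice_succ_iff, rivalBudget_succ_eq (a + 1) n, rivalBudget_succ_succ] at h
      refine absurd (iha n (x := x) ?_) hp.not_ge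
      by_contra! hlt
      have := rivalBudget_mono (a + 1) n m
        (show x - p ≤ x - latePrice a (n + 1) x m by linarith)
      linarith
    induction n generalizing x with
    | zero => exact le_latePrice_zero_of_le (key 0 x h)
    | succ n ihn => exact le_latePrice_succ_of_le (key (n + 1) x h) (ihn (key (n + 1) x h))

/-- The prices do not increase. -/
theorem latePrice_le_latePrice_succ (a n : ℕ) (x m : ℝ) :
    latePrice a n x m ≤ latePrice (a + 1) n x m := by
  cases n with
  | zero =>
    have h := le_latePrice_zero_iff.1 (le_refl (latePrice a 0 x m))
    rw [le_latePrice_zero_iff]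
    refine h.imp_right fun h => ?_
    rw [rivalBudget_succ_eq]
    have h2 := half_mul_le_rivalBudget a x m
    have h3 : (a + 2) * (2 * latePrice a 0 x m) ≤ (a + 2) * x := by linarith
    have h4 := le_of_mul_le_mul_left h3 (by positivity)
    push_cast
    linarith
  | succ n =>
    -- After winning at the price `p = latePrice a (n + 1) x m`, the claim becomes `p ≤ latePrice (a
    -- + 1) n (x - p) m`.
    rw [le_latePrice_succ_iff, rivalBudget_succ_succ, add_comm]
    have h := le_latePrice_of_le_latePrice_succ a n (le_refl (latePrice a (n + 1) x m))
    have h2 := rivalBudget_succ_eq (a + 1) n (x - latePrice a (n + 1) x m) m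
    linarith

end SeqAuction


/-! ### Generic and contested outcomes, and their dependence on the budgets -/

namespace SeqAuction

/-- An agent with budget `x` wins the last `n + 1` items for `z` each and keeps `m`, after her rival
with budget `y` has won `a + 1` items and kept `z`. -/
structure LateOutcome (a n : ℕ) (x y m z : ℝ) : Prop where
  nonneg : 0 ≤ z
  le : z ≤ m
  budget_eq : x = m + (n + 1) * z
  rival_eq : y = rivalBudget (a + 1) n x m

/-- In the (generic) canonical outcome, the agent with budget `x` wins `n` items and keeps `m`, and
her rival with budget `y` wins `n'` items and keeps `m'`. -/
inductive Outcome (x y : ℝ) (n n' : ℕ) (m m' : ℝ) : Prop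
  | poor (hn : n = 0) (hm : m = x) (hm' : m' = y - n' * x) (h : 0 ≤ m')
  | rich (hn' : n' = 0) (hm' : m' = y) (hm : m = x - n * y) (h : 0 ≤ m)
  | late (a b : ℕ) (hn : n = b + 1) (hn' : n' = a + 1) (h : LateOutcome a b x y m m')
  | early (a b : ℕ) (hn : n = b + 1) (hn' : n' = a + 1) (h : LateOutcome b a y x m' m)

/-- An outcome in which no item is contested. -/
inductive StrictOutcome (x y : ℝ) (n n' : ℕ) (m m' : ℝ) : Prop
  | poor (hn : n = 0) (hm : m = x) (hm' : m' = y - n' * x) (h : 0 < m')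
  | rich (hn' : n' = 0) (hm' : m' = y) (hm : m = x - n * y) (h : 0 < m)
  | late (a b : ℕ) (hn : n = b + 1) (hn' : n' = a + 1) (h : LateOutcome a b x y m m') (hz : 0 < m')
  | early (a b : ℕ) (hn : n = b + 1) (hn' : n' = a + 1) (h : LateOutcome b a y x m' m) (hz : 0 < m)

/-- The budgets `x` and `y` are such that one item is contested, the agents winning `n` and `a` of
the other items. -/
structure Contested (a n : ℕ) (x y : ℝ) : Prop where
  pos : 0 < x
  rival_pos : 0 < y
  eq : y = jumpRatio (a + 1) n * x

theorem StrictOutcome.outcome {x y m m' : ℝ} {n n' : ℕ} (h : StrictOutcome x y n n' m m') :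
    Outcome x y n n' m m' := by
  cases h with
  | poor hn hm hm' h => exact .poor hn hm hm' h.le
  | rich hn hm hm' h => exact .rich hn hm hm' h.le
  | late a b hn hn' h hz => exact .late a b hn hn' h
  | early a b hn hn' h hz => exact .early a b hn hn' h

theorem Outcome.symm {x y m m' : ℝ} {n n' : ℕ} (h : Outcome x y n n' m m') :
    Outcome y x n' n m' m := by
  cases h with
  | poor hn hm hm' h => exact .rich hn hm hm' h
  | rich hn hm hm' h => exact .poor hn hm hm' h
  | late a b hn hn' h => exact .early b a hn' hn h
  | early a b hn hn' h => exact .late b a hn' hn h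

theorem StrictOutcome.symm {x y m m' : ℝ} {n n' : ℕ} (h : StrictOutcome x y n n' m m') :
    StrictOutcome y x n' n m' m := by
  cases h with
  | poor hn hm hm' h => exact .rich hn hm hm' h
  | rich hn hm hm' h => exact .poor hn hm hm' h
  | late a b hn hn' h hz => exact .early b a hn' hn h hz
  | early a b hn hn' h hz => exact .late b a hn' hn h hz

theorem Contested.symm {x y : ℝ} {a n : ℕ} (h : Contested a n x y) : Contested n a y x := by
  refine ⟨h.rival_pos, h.pos, ?_⟩
  rw [h.eq]
  linear_combination (-x) * jumpRatio_dual a n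

/-- A threshold is the degenerate end `z = 0` of a generic outcome, with the rival's money
exhausted. -/
theorem outcome_of_eq_jumpRatio_mul {x y : ℝ} (a n : ℕ) (hx : 0 ≤ x) (h : y = jumpRatio a n * x) :
    Outcome x y n a x 0 := by
  cases n with
  | zero =>
    rw [jumpRatio_zero_right] at h
    exact .poor rfl rfl (by rw [h]; ring) le_rfl
  | succ n =>
    cases a with
    | zero =>
      rw [jumpRatio_zero_left] at h
      exact .rich rfl (by rw [h]; ring) (by rw [h]; ring) hx
    | succ a =>
      exact .late a n rfl rfl ⟨le_rfl, hx, by ring, by rw [rivalBudget_of_le _ _ hx le_rfl, h]⟩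

theorem Contested.outcome {x y : ℝ} {a n : ℕ} (h : Contested a n x y) :
    Outcome x y n (a + 1) x 0 :=
  outcome_of_eq_jumpRatio_mul _ _ h.pos.le h.eq

theorem Contested.outcome_succ {x y : ℝ} {a n : ℕ} (h : Contested a n x y) :
    Outcome x y (n + 1) a 0 y :=
  h.symm.outcome.symm

theorem jumpRatio_mul_le (a n : ℕ) : jumpRatio a (n + 1) * (n + 2) ≤ a + 1 := by
  have h := rivalBudget_of_eq_mul a n zero_le_one
  have h2 := rivalBudget_anti a n ((n + 2) * 1) (m := 1) (m' := (n + 2) * 1) (by linarith)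
  rw [rivalBudget_of_le _ _ (by positivity) le_rfl] at h2
  linarith

theorem jumpRatio_antitone {a n a' n' : ℕ} (h : n' ≤ n) (hs : a + n = a' + n') :
    jumpRatio a n ≤ jumpRatio a' n' := by
  induction n, h using Nat.le_induction generalizing a with
  | base => rw [show a = a' by omega]
  | succ n hn ih => exact (jumpRatio_anti a n).trans (ih (by omega))

namespace LateOutcome

variable {a n : ℕ} {x y m z : ℝ}

theorem le_budget (h : LateOutcome a n x y m z) : m ≤ x := by
  rw [h.budget_eq]; have := h.nonneg; nlinarith

theorem budget_le (h : LateOutcome a n x y m z) : x ≤ (n + 2) * m := by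
  rw [h.budget_eq]; nlinarith [h.le]

theorem mul_le_budget (h : LateOutcome a n x y m z) : (n + 2) * z ≤ x := by
  rw [h.budget_eq]; linarith [h.le]

theorem budget_nonneg (h : LateOutcome a n x y m z) : 0 ≤ x := by
  have := h.nonneg
  have := h.le.trans h.le_budget
  linarith

theorem rival_le_mul (h : LateOutcome a n x y m z) : y ≤ (a + 2) * m := by
  rw [h.rival_eq]
  have h2 := rivalBudget_of_eq_mul (a + 1) n (h.nonneg.trans h.le)
  have h3 := rivalBudget_mono (a + 1) n m h.budget_le
  push_cast at h2
  linarith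

theorem mul_le_rival (h : LateOutcome a n x y m z) : (a + 2) * z ≤ y := by
  have h2 := mul_le_rivalBudget (a + 1) n m h.nonneg
  rw [← h.budget_eq, ← h.rival_eq] at h2
  push_cast at h2
  linarith

theorem mul_rival_le (h : LateOutcome a n x y m z) : (n + 2) * y ≤ (a + 2) * x := by
  have hp : (0 : ℝ) < n + 2 := by positivity
  have hx := h.budget_nonneg
  have h2 := rivalBudget_of_eq_mul (a + 1) n (m := x / (n + 2)) (by positivity)
  rw [mul_div_cancel₀ _ hp.ne'] at h2
  have h3 := rivalBudget_anti (a + 1) n x (m := x / (n + 2)) (m' := m)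
    ((div_le_iff₀ hp).2 (by linarith [h.budget_le]))
  rw [← h.rival_eq, h2] at h3
  push_cast at h3
  calc (n + 2) * y ≤ (n + 2) * ((a + 1 + 1) * (x / (n + 2))) := by gcongr
    _ = _ := by field_simp; ring

theorem jumpRatio_mul_le_rival (h : LateOutcome a n x y m z) :
    jumpRatio (a + 1) (n + 1) * x ≤ y := by
  rw [h.rival_eq, ← rivalBudget_of_le _ _ h.budget_nonneg le_rfl]
  exact rivalBudget_anti _ _ _ h.le_budget

theorem jumpRatio_mul_rival_le (h : LateOutcome a n x y m z) :
    jumpRatio (n + 1) (a + 1) * y ≤ x := by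
  have h1 := jumpRatio_mul_le (n + 1) a
  have h2 := h.mul_rival_le
  have h3 : 0 ≤ y := by have := h.mul_le_rival; have := h.nonneg; nlinarith
  push_cast at h1
  have h4 : (a + 2) * (jumpRatio (n + 1) (a + 1) * y) ≤ (a + 2) * x := by
    nlinarith [mul_le_mul_of_nonneg_right h1 h3]
  exact le_of_mul_le_mul_left h4 (by positivity)

end LateOutcome

theorem Outcome.jumpRatio_mul_le {x y m m' : ℝ} {n n' : ℕ} (h : Outcome x y n n' m m')
    (hy : 0 ≤ y) : jumpRatio n' n * x ≤ y := by
  cases h with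
  | poor hn hm hm' h => rw [hn, jumpRatio_zero_right]; linarith
  | rich hn hm hm' h => rw [hn, jumpRatio_zero_left]; linarith
  | late a b hn hn' h => rw [hn, hn']; exact h.jumpRatio_mul_le_rival
  | early a b hn hn' h => rw [hn, hn']; exact h.jumpRatio_mul_rival_le

/-- The number of items confines the budget ratio between consecutive thresholds, so different
numbers are separated by a threshold `r`. -/
theorem Outcome.exists_mul_le_of_lt {x y m m' x₂ y₂ m₂ m₂' : ℝ} {n n' n₂ n₂' : ℕ}
    (h : Outcome x y n n' m m') (h₂ : Outcome x₂ y₂ n₂ n₂' m₂ m₂') (hx : 0 ≤ x) (hx₂ : 0 ≤ x₂)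
    (hy₂ : 0 ≤ y₂) (hs : n + n' = n₂ + n₂') (hn : n₂ < n) :
    ∃ r, 0 < r ∧ r * x₂ ≤ y₂ ∧ y ≤ r * x := by
  obtain ⟨b, rfl⟩ : ∃ b, n = b + 1 := ⟨n - 1, by omega⟩
  have hr := jumpRatio_pos n' b
  refine ⟨jumpRatio (n' + 1) b, hr, ?_, ?_⟩
  · refine le_trans ?_ (h₂.jumpRatio_mul_le hy₂)
    gcongr
    exact jumpRatio_antitone (by omega) (by omega)
  · have h1 := h.symm.jumpRatio_mul_le hx
    have h2 := jumpRatio_dual n' b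
    calc y = jumpRatio (n' + 1) b * (jumpRatio (b + 1) n' * y) := by rw [← mul_assoc, h2, one_mul]
      _ ≤ _ := mul_le_mul_of_nonneg_left h1 hr.le

/-- With equal item counts, strict monotonicity of `rivalBudget` decides unless the roles of early
and late winner change; then comparing budgets per item decides. -/
theorem Outcome.lt_of_budget_lt {x y m m' x₂ m₂ m₂' : ℝ} {n n' n₂ n₂' : ℕ}
    (h : Outcome x y n n' m m') (h₂ : Outcome x₂ y n₂ n₂' m₂ m₂') (hx : 0 ≤ x)
    (hy : 0 ≤ y) (hs : n + n' = n₂ + n₂') (hpos : 0 < n + n') (hlt : x < x₂) :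
    n < n₂ ∨ n = n₂ ∧ m < m₂ := by
  rcases lt_trichotomy n n₂ with hn | hn | hn
  · exact Or.inl hn
  swap
  · obtain ⟨r, hr, h1, h2⟩ := h.exists_mul_le_of_lt h₂ hx (hx.trans hlt.le) hy hs hn
    nlinarith
  refine Or.inr ⟨hn, ?_⟩
  obtain rfl : n' = n₂' := by omega
  subst hn
  cases h with
  | poor hn hm hm' h =>
    cases h₂ with
    | poor => linarith
    | rich => omega
    | late => omega
    | early => omega
  | rich hn hm hm' h =>
    cases h₂ with
    | poor => omega
    | rich => linarith
    | late => omega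
    | early => omega
  | late a b hn hn' h =>
    cases h₂ with
    | poor => omega
    | rich => omega
    | late a₂ b₂ hn₂ hn₂' h₂ =>
      obtain rfl : a = a₂ := by omega
      obtain rfl : b = b₂ := by omega
      by_contra! hle
      have h3 := rivalBudget_anti (a + 1) b x hle
      have h4 := rivalBudget_strictMono a b m₂ hlt
      rw [← h.rival_eq] at h3
      rw [← h₂.rival_eq] at h4
      linarith
    | early a₂ b₂ hn₂ hn₂' h₂ =>
      obtain rfl : a = a₂ := by omega
      obtain rfl : b = b₂ := by omega
      have h3 := h.mul_rival_le
      have h4 := h₂.mul_rival_le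
      have : (a + 2) * x < (a + 2) * x₂ := by gcongr
      linarith
  | early a b hn hn' h =>
    cases h₂ with
    | poor => omega
    | rich => omega
    | late a₂ b₂ hn₂ hn₂' h₂ =>
      obtain rfl : a = a₂ := by omega
      obtain rfl : b = b₂ := by omega
      -- Becoming the late winner means crossing the balanced case, where `m = m₂`; this equality
      -- leaves no room for `x < x₂`.
      by_contra! hle
      have h3 := h.mul_le_budget
      have h4 := h₂.rival_le_mul
      have h5 : (a + 2) * m ≤ (a + 2) * m₂ := by linarith
      have h6 := le_of_mul_le_mul_left h5 (by positivity)
      have h7 : m = m₂ := le_antisymm h6 hle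
      subst h7
      have h8 := h₂.budget_le
      have h9 := h.mul_le_rival
      linarith
    | early a₂ b₂ hn₂ hn₂' h₂ =>
      obtain rfl : a = a₂ := by omega
      obtain rfl : b = b₂ := by omega
      by_contra! hle
      have h1 := h.budget_eq
      have h2 := h₂.budget_eq
      have h3 : m' ≤ m₂' := by nlinarith
      have h4 := rivalBudget_anti (b + 1) a y h3
      rw [← h.rival_eq, ← h₂.rival_eq] at h4
      linarith

theorem Outcome.le_of_rival_le {x y m m' y₂ m₂ m₂' : ℝ} {n n' n₂ n₂' : ℕ}
    (h : Outcome x y n n' m m') (h₂ : Outcome x y₂ n₂ n₂' m₂ m₂') (hx : 0 ≤ x)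
    (hy : 0 ≤ y) (hs : n + n' = n₂ + n₂') (hpos : 0 < n + n') (hlt : y < y₂) :
    n₂ < n ∨ n₂ = n ∧ m₂ ≤ m := by
  rcases lt_trichotomy n₂ n with hn | hn | hn
  · exact Or.inl hn
  swap
  · obtain ⟨r, hr, h1, h2⟩ := h₂.exists_mul_le_of_lt h hx hx hy hs.symm hn
    linarith
  refine Or.inr ⟨hn, ?_⟩
  obtain rfl : n' = n₂' := by omega
  subst hn
  cases h with
  | poor hn hm hm' h =>
    cases h₂ with
    | poor => linarith
    | rich => omega
    | late => omega
    | early => omega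
  | rich hn hm hm' h =>
    cases h₂ with
    | poor => omega
    | rich => nlinarith
    | late => omega
    | early => omega
  | late a b hn hn' h =>
    cases h₂ with
    | poor => omega
    | rich => omega
    | late a₂ b₂ hn₂ hn₂' h₂ =>
      obtain rfl : a = a₂ := by omega
      obtain rfl : b = b₂ := by omega
      by_contra! hle
      have h3 := rivalBudget_anti (a + 1) b x hle.le
      rw [← h.rival_eq, ← h₂.rival_eq] at h3
      linarith
    | early a₂ b₂ hn₂ hn₂' h₂ =>
      obtain rfl : a = a₂ := by omega
      obtain rfl : b = b₂ := by omega
      have h3 := h.budget_le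
      have h4 := h₂.mul_le_rival
      have h5 : (b + 2) * m₂ ≤ (b + 2) * m := by linarith
      exact le_of_mul_le_mul_left h5 (by positivity)
  | early a b hn hn' h =>
    cases h₂ with
    | poor => omega
    | rich => omega
    | late a₂ b₂ hn₂ hn₂' h₂ =>
      obtain rfl : a = a₂ := by omega
      obtain rfl : b = b₂ := by omega
      have h3 := h.mul_rival_le
      have h4 := h₂.mul_rival_le
      have : (b + 2) * y < (b + 2) * y₂ := by gcongr
      linarith
    | early a₂ b₂ hn₂ hn₂' h₂ =>
      obtain rfl : a = a₂ := by omega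
      obtain rfl : b = b₂ := by omega
      -- If `m < m₂`, the richer rival keeps less than all of her extra budget and would therefore
      -- require `x` to be strictly larger.
      have h3 := rivalBudget_le_shift (b + 1) a y m' (sub_nonneg.2 hlt.le)
      rw [add_sub_cancel, ← h.rival_eq] at h3
      have h1 := h.budget_eq
      have h2 := h₂.budget_eq
      by_contra! hle
      have h5 : m₂' < m' + (y₂ - y) := by nlinarith
      have h6 := rivalBudget_strictAnti (b + 1) a (x := y₂) h5 (by nlinarith [h₂.nonneg, h.nonneg])
      rw [← h₂.rival_eq] at h6
      linarith

/-- As `m` runs from `x / (n + 2)` to `x`, the rival's budget runs from the balanced value down to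
the threshold; the intermediate value theorem supplies `m`. -/
theorem exists_lateOutcome {a n : ℕ} {x y : ℝ} (hx : 0 < x) (h1 : (n + 2) * y ≤ (a + 2) * x)
    (h2 : jumpRatio (a + 1) (n + 1) * x < y) : ∃ m z, 0 < z ∧ LateOutcome a n x y m z := by
  have hp : (0 : ℝ) < n + 2 := by positivity
  have hc : Continuous fun m => rivalBudget (a + 1) n x m :=
    (rivalBudget_continuous (a + 1) n).comp (by fun_prop : Continuous fun m : ℝ => (x, m))
  have e := rivalBudget_of_eq_mul (a + 1) n (m := x / (n + 2)) (by positivity)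
  rw [mul_div_cancel₀ _ hp.ne'] at e
  have e2 := rivalBudget_of_le (a + 1) n hx.le le_rfl
  have hle : x / (n + 2) ≤ x := by
    rw [div_le_iff₀ hp]; nlinarith [(Nat.cast_nonneg n : (0 : ℝ) ≤ n)]
  have hmem : y ∈ Set.Ioc (rivalBudget (a + 1) n x x) (rivalBudget (a + 1) n x (x / (n + 2))) := by
    rw [e, e2]
    refine ⟨h2, ?_⟩
    rw [← mul_div_assoc, le_div_iff₀ hp]
    push_cast; linarith
  obtain ⟨m, hm, rfl⟩ := intermediate_value_Icc' hle hc.continuousOn ⟨hmem.1.le, hmem.2⟩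
  have hlt : m < x := by
    rcases hm.2.lt_or_eq with h | h
    · exact h
    · rw [h] at hmem; exact absurd hmem.1 (lt_irrefl _)
  have hp1 : (0 : ℝ) < n + 1 := by positivity
  have hz : x - m = (n + 1) * ((x - m) / (n + 1)) := by field_simp
  have h3 := (div_le_iff₀ hp).1 hm.1
  have hzp : 0 < (x - m) / (n + 1) := div_pos (by linarith) hp1
  refine ⟨m, (x - m) / (n + 1), hzp, hzp.le, ?_, by linarith, rfl⟩
  rw [div_le_iff₀ hp1]; linarith

theorem exists_strictOutcome_or_contested {k : ℕ} {x y : ℝ} (hx : 0 ≤ x) (hy : 0 ≤ y)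
    (hxy : 0 < x + y) :
    (∃ n n' m m', n + n' = k ∧ StrictOutcome x y n n' m m') ∨
      ∃ a n, a + n + 1 = k ∧ Contested a n x y := by
  classical
  rcases hx.eq_or_lt with rfl | hx
  · exact Or.inl ⟨0, k, 0, y - k * 0, by simp, .poor rfl rfl rfl (by linarith)⟩
  rcases hy.eq_or_lt with rfl | hy
  · exact Or.inl ⟨k, 0, x - k * 0, 0, by simp, .rich rfl rfl rfl (by linarith)⟩
  -- The least such `n` is the number of items won. Equality means a contested item; otherwise the
  -- larger budget per item determines the late winner.
  have hex : ∃ n, n ≤ k ∧ jumpRatio (k - n) n * x ≤ y :=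
    ⟨k, le_rfl, by rw [Nat.sub_self, jumpRatio_zero_left]; linarith⟩
  obtain ⟨hn, hle⟩ := Nat.find_spec hex
  have hmin := fun j hj => Nat.find_min hex (m := j) hj
  set n := Nat.find hex
  rcases hle.eq_or_lt with heq | hlt
  · obtain ⟨a, ha⟩ : ∃ a, k - n = a + 1 := by
      refine ⟨k - n - 1, ?_⟩
      have : k - n ≠ 0 := fun h0 => by rw [h0, jumpRatio_zero_left] at heq; linarith
      omega
    exact Or.inr ⟨a, n, by omega, hx, hy, by rw [← ha, heq]⟩
  rcases Nat.eq_zero_or_pos n with h0 | h0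
  · rw [h0, jumpRatio_zero_right, Nat.sub_zero] at hlt
    exact Or.inl ⟨0, k, x, y - k * x, by simp, .poor rfl rfl rfl (by linarith)⟩
  obtain ⟨b, hb⟩ : ∃ b, n = b + 1 := ⟨n - 1, by omega⟩
  have hgt : y < jumpRatio (k - b) b * x := by
    have := hmin b (by omega)
    push Not at this
    exact this (by omega)
  rw [hb] at hlt hn
  have hd := jumpRatio_dual (k - (b + 1)) b
  rw [show k - (b + 1) + 1 = k - b by omega] at hd
  have hlt' : jumpRatio (b + 1) (k - (b + 1)) * y < x := by
    have hp := jumpRatio_pos b (k - (b + 1))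
    nlinarith [mul_lt_mul_of_pos_left hgt hp]
  rcases hn.eq_or_lt with hbk | hbk
  · rw [hbk, Nat.sub_self, jumpRatio_zero_right] at hlt'
    exact Or.inl ⟨k, 0, x - k * y, y, by simp, .rich rfl rfl rfl (by linarith)⟩
  obtain ⟨a, ha⟩ : ∃ a, k - (b + 1) = a + 1 := ⟨k - (b + 1) - 1, by omega⟩
  rw [ha] at hlt hlt'
  rcases le_total ((b + 2) * y) ((a + 2) * x) with h | h
  · obtain ⟨m, z, hz, ho⟩ := exists_lateOutcome hx h hlt
    exact Or.inl ⟨b + 1, a + 1, m, z, by omega, .late a b rfl rfl ho hz⟩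
  · obtain ⟨m, z, hz, ho⟩ := exists_lateOutcome hy h hlt'
    exact Or.inl ⟨b + 1, a + 1, z, m, by omega, .early a b rfl rfl ho hz⟩

end SeqAuction


/-! ### Bids, winners and critical prices -/

namespace SeqAuction

section Bids

@[simp] theorem pay_self (B : Agent → ℝ) (i : Agent) (p : ℝ) : pay B i p i = B i - p := by
  simp [pay]

@[simp] theorem pay_rival (B : Agent → ℝ) (i : Agent) (p : ℝ) : pay B i p (!i) = B (!i) := by
  cases i <;> simp [pay]

@[simp] theorem pay_not_self (B : Agent → ℝ) (i : Agent) (p : ℝ) : pay B (!i) p i = B i := by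
  cases i <;> simp [pay]

theorem agent_ext {α : Type*} {B B' : Agent → α} (i : Agent) (h : B i = B' i)
    (h' : B (!i) = B' (!i)) : B = B' := by
  funext j
  cases i <;> cases j <;> simp_all

theorem forall_agent {P : Agent → Prop} (i : Agent) (h : P i) (h' : P (!i)) : ∀ j, P j := by
  intro j
  cases i <;> cases j <;> simp_all

theorem thresholdBids_amount (r : Agent → ℝ) (i : Agent) :
    (thresholdBids r i).amount = min (r i) (r (!i)) := by
  unfold thresholdBids
  split_ifs with h
  · rw [min_eq_right h.le]
  · rw [min_eq_left (not_lt.1 h)]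

theorem winners_thresholdBids_of_lt {r : Agent → ℝ} {i : Agent} (h : r i < r (!i)) :
    winners (thresholdBids r) = {!i} := by
  have h1 : thresholdBids r i = ⟨r i, false⟩ := if_neg h.not_gt
  have h2 : thresholdBids r (!i) = ⟨r i, true⟩ := by simp [thresholdBids, h]
  ext j
  revert j
  refine forall_agent (P := fun j => j ∈ _ ↔ j ∈ _) i ?_ ?_
  · simp [winners, Bid.Beats, h1, h2]
  · simp [winners, Bid.Beats, h1, h2]

theorem winners_thresholdBids_of_eq {r : Agent → ℝ} {i : Agent} (h : r i = r (!i)) :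
    winners (thresholdBids r) = Finset.univ := by
  ext j
  revert j
  refine forall_agent (P := fun j => j ∈ _ ↔ j ∈ _) i ?_ ?_ <;> cases i <;> simp_all [winners, thresholdBids, Bid.Beats]

theorem utility_succ_loser {v B r : Agent → ℝ} {k : ℕ} {i : Agent}
    (hb : canonicalBids v (utility v k) (k + 1) B = thresholdBids r) (h : r i < r (!i)) :
    utility v (k + 1) B i = losingUtility (utility v k) B i (r i) := by
  rw [utility, hb, winners_thresholdBids_of_lt h]
  simp [thresholdBids_amount, min_eq_right h.le]

theorem utility_succ_winner {v B r : Agent → ℝ} {k : ℕ} {i : Agent}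
    (hb : canonicalBids v (utility v k) (k + 1) B = thresholdBids r) (h : r (!i) < r i) :
    utility v (k + 1) B i = winningUtility v (utility v k) B i (r (!i)) := by
  rw [utility, hb, winners_thresholdBids_of_lt (i := !i) (by simpa using h)]
  simp [thresholdBids_amount, min_eq_right h.le]

theorem utility_succ_tie {v B r : Agent → ℝ} {k : ℕ} {i : Agent}
    (hb : canonicalBids v (utility v k) (k + 1) B = thresholdBids r) (h : r i = r (!i)) :
    utility v (k + 1) B i = (winningUtility v (utility v k) B i (r i) +
      losingUtility (utility v k) B i (r i)) / 2 := by
  rw [utility, hb, winners_thresholdBids_of_eq h]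
  cases i <;> simp_all [thresholdBids_amount]
  ring

theorem canonicalBids_of_lopsided {v B : Agent → ℝ} {u : (Agent → ℝ) → Agent → ℝ} {k : ℕ}
    (h : k = 1 ∨ Lopsided k B) : canonicalBids v u k B = thresholdBids B := by
  rw [canonicalBids, if_pos h]

theorem canonicalBids_of_not_lopsided {v B : Agent → ℝ} {u : (Agent → ℝ) → Agent → ℝ} {k : ℕ}
    (hk : k ≠ 1) (h : ¬ Lopsided k B) :
    canonicalBids v u k B = thresholdBids (criticalPrice v u B) := by
  rw [canonicalBids, if_neg (by tauto)]

theorem IsCriticalPrice.unique {v B : Agent → ℝ} {u : (Agent → ℝ) → Agent → ℝ} {i : Agent}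
    {p q : ℝ} (hp : IsCriticalPrice v u B i p) (hq : IsCriticalPrice v u B i q) : p = q := by
  have key : ∀ p q, IsCriticalPrice v u B i p → IsCriticalPrice v u B i q → ¬ p < q := by
    intro p q hp hq hlt
    have hmem : (p + q) / 2 ∈ Set.Icc 0 (min (B i) (B !i)) :=
      ⟨by linarith [hp.1.1, hq.1.1], by linarith [hp.1.2, hq.1.2]⟩
    exact lt_asymm (hp.2.1 _ hmem (by linarith)) (hq.2.2 _ hmem (by linarith))
  exact le_antisymm (not_lt.1 (key q p hq hp)) (not_lt.1 (key p q hp hq))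

theorem IsCriticalPrice.criticalPrice_eq {v B : Agent → ℝ} {u : (Agent → ℝ) → Agent → ℝ}
    {i : Agent} {p : ℝ} (hp : IsCriticalPrice v u B i p) : criticalPrice v u B i = p :=
  (Classical.epsilon_spec (p := IsCriticalPrice v u B i) ⟨p, hp⟩).unique hp

/-- A price at which an agent weakly prefers winning is at most her critical price. -/
theorem IsCriticalPrice.le_of_le {v B : Agent → ℝ} {u : (Agent → ℝ) → Agent → ℝ} {i : Agent}
    {p q : ℝ} (hp : IsCriticalPrice v u B i p) (hq : q ∈ Set.Icc 0 (min (B i) (B !i)))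
    (hle : losingUtility u B i q ≤ winningUtility v u B i q) : q ≤ p := by
  by_contra! hlt
  exact absurd (hp.2.1 q hq hlt) hle.not_gt

theorem exists_isCriticalPrice {v B : Agent → ℝ} {u : (Agent → ℝ) → Agent → ℝ} {i : Agent}
    (hB : 0 ≤ min (B i) (B !i))
    (h : ∀ p q, 0 ≤ p → p < q → q ≤ min (B i) (B !i) →
      winningUtility v u B i q - losingUtility u B i q <
        winningUtility v u B i p - losingUtility u B i p) :
    ∃ p, IsCriticalPrice v u B i p := by
  set D := fun q => winningUtility v u B i q - losingUtility u B i q with hD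
  -- Including `0` makes the supremum meaningful when losing is preferred at every price.
  set S := {q | q = 0 ∨ q ∈ Set.Icc 0 (min (B i) (B !i)) ∧ 0 < D q} with hS
  have hne : S.Nonempty := ⟨0, Or.inl rfl⟩
  have hub : ∀ q ∈ S, q ≤ min (B i) (B !i) := by
    rintro q (rfl | hq)
    exacts [hB, hq.1.2]
  have hbdd : BddAbove S := ⟨_, hub⟩
  refine ⟨sSup S, ⟨le_csSup hbdd (Or.inl rfl), csSup_le hne hub⟩, fun q hq hlt => ?_,
    fun q hq hlt => ?_⟩
  · by_contra! hle
    rcases hle.eq_or_lt with heq | hlt'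
    · have h0 : 0 ≤ sSup S := le_csSup hbdd (Or.inl rfl)
      have hmem : (sSup S + q) / 2 ∈ S := by
        refine Or.inr ⟨⟨by linarith, by linarith [hq.2]⟩, ?_⟩
        have := h ((sSup S + q) / 2) q (by linarith) (by linarith) hq.2
        simp only [hD]; linarith
      have := le_csSup hbdd hmem
      linarith
    · have hmem : q ∈ S := Or.inr ⟨hq, by simp only [hD]; linarith⟩
      exact absurd (le_csSup hbdd hmem) hlt.not_ge
  · obtain ⟨s, hs, hqs⟩ := exists_lt_of_lt_csSup hne hlt
    rcases hs with rfl | hs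
    · exact absurd hq.1 hqs.not_ge
    · have h1 := h q s hq.1 hqs hs.1.2
      have h2 := hs.2
      simp only [hD] at h2
      linarith

theorem lopsided_iff {k : ℕ} {B : Agent → ℝ} (i : Agent) :
    Lopsided k B ↔ k * B i < B (!i) ∨ k * B (!i) < B i := by
  cases i <;> simp [Lopsided, or_comm]

end Bids

/-! ### Utilities compared through outcomes -/

/-- The budgets are nonnegative and small compared to the values. -/
def Admissible (v : Agent → ℝ) (k : ℕ) (B : Agent → ℝ) : Prop :=
  ∀ i, 0 ≤ B i ∧ 2 ^ k * B i < v i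

theorem Admissible.nonneg {v B : Agent → ℝ} {k : ℕ} (h : Admissible v k B) (i : Agent) :
    0 ≤ B i := (h i).1

theorem Admissible.value_pos {v B : Agent → ℝ} {k : ℕ} (h : Admissible v k B) (i : Agent) :
    0 < v i :=
  lt_of_le_of_lt (mul_nonneg (by positivity) (h i).1) (h i).2

theorem Admissible.lt {v B : Agent → ℝ} {k : ℕ} (h : Admissible v k B) (i : Agent) :
    B i < v i := by
  have h1 : (1 : ℝ) ≤ 2 ^ k := one_le_pow₀ (by norm_num)
  nlinarith [(h i).1, (h i).2]

theorem Admissible.lt_div {v B : Agent → ℝ} {k : ℕ} (h : Admissible v k B) (i : Agent) :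
    B i < v i / 2 ^ k := by
  rw [lt_div_iff₀ (by positivity)]; linarith [(h i).2]

theorem Admissible.of_le {v B B' : Agent → ℝ} {k : ℕ} (h : Admissible v k B)
    (h0 : ∀ i, 0 ≤ B' i) (hle : ∀ i, B' i ≤ B i) : Admissible v k B' := fun i =>
  ⟨h0 i, lt_of_le_of_lt (by gcongr; exact hle i) (h i).2⟩

theorem Admissible.pay {v B : Agent → ℝ} {k : ℕ} (h : Admissible v (k + 1) B) {w : Agent} {p : ℝ}
    (hp : 0 ≤ p) (hpw : p ≤ B w) : Admissible v k (pay B w p) := by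
  have h2 : Admissible v k B := fun i => ⟨(h i).1, lt_of_le_of_lt (by
    have := (h i).1
    gcongr
    · norm_num
    · omega) (h i).2⟩
  refine h2.of_le (forall_agent w ?_ ?_) (forall_agent w ?_ ?_)
  · simpa using hpw
  · simpa using (h _).1
  · simpa using hp
  · simp

/-- With `k` items, the expected utilities are those in the generic outcome, and otherwise the
contested item is won by either agent with probability at least `2⁻ᵏ`. -/
structure UtilityDescribed (v : Agent → ℝ) (k : ℕ) : Prop where
  strict : ∀ (B : Agent → ℝ) (i : Agent) (n n' : ℕ) (m m' : ℝ), Admissible v k B →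
    StrictOutcome (B i) (B !i) n n' m m' → n + n' = k → utility v k B i = v i * n + m
  contested_le : ∀ (B : Agent → ℝ) (i : Agent) (a n : ℕ), Admissible v k B →
    Contested a n (B i) (B !i) → a + n + 1 = k → v i * n + v i / 2 ^ k ≤ utility v k B i
  le_contested : ∀ (B : Agent → ℝ) (i : Agent) (a n : ℕ), Admissible v k B →
    Contested a n (B i) (B !i) → a + n + 1 = k → utility v k B i ≤ v i * (n + 1) - v i / 2 ^ k + B i

theorem Outcome.money_nonneg {x y m m' : ℝ} {n n' : ℕ} (h : Outcome x y n n' m m') (hx : 0 ≤ x) :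
    0 ≤ m := by
  cases h with
  | poor hn hm hm' h => linarith
  | rich hn hm hm' h => exact h
  | late a b hn hn' h => exact h.nonneg.trans h.le
  | early a b hn hn' h => exact h.nonneg

theorem Outcome.money_le {x y m m' : ℝ} {n n' : ℕ} (h : Outcome x y n n' m m') (hy : 0 ≤ y) :
    m ≤ x := by
  cases h with
  | poor hn hm hm' h => linarith
  | rich hn hm hm' h => have : 0 ≤ n * y := by positivity
                        linarith
  | late a b hn hn' h => exact h.le_budget
  | early a b hn hn' h =>
    have := h.mul_le_rival
    have := h.nonneg
    nlinarith

/-- Turns the lexicographic order of outcomes into the order of utilities. -/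
theorem add_money_lt {v m m₂ : ℝ} {n n₂ : ℕ} (h : n < n₂ ∨ n = n₂ ∧ m < m₂) (hm : m < v)
    (hv : 0 < v) (hm₂ : 0 ≤ m₂) : v * n + m < v * n₂ + m₂ := by
  rcases h with h | ⟨rfl, h⟩
  · have : (n : ℝ) + 1 ≤ n₂ := by exact_mod_cast h
    nlinarith
  · linarith

theorem add_money_le {v m m₂ : ℝ} {n n₂ : ℕ} (h : n < n₂ ∨ n = n₂ ∧ m ≤ m₂) (hm : m < v)
    (hv : 0 < v) (hm₂ : 0 ≤ m₂) : v * n + m ≤ v * n₂ + m₂ := by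
  rcases h with h | ⟨rfl, h⟩
  · exact (add_money_lt (Or.inl h) hm hv hm₂).le
  · linarith

namespace UtilityDescribed

variable {v B B' : Agent → ℝ} {k : ℕ} {i : Agent}

/-- In the contested case the lower outcome is `n` items with the whole budget left. Together with
`exists_le_outcome`, this reduces comparisons of utilities to outcomes. -/
theorem exists_outcome_le (D : UtilityDescribed v k) (hB : Admissible v k B)
    (hpos : 0 < B i + B (!i)) : ∃ n n' m m', n + n' = k ∧ Outcome (B i) (B !i) n n' m m' ∧
      v i * n + m ≤ utility v k B i := by
  rcases exists_strictOutcome_or_contested (k := k) (hB.nonneg i) (hB.nonneg _) hpos with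
    ⟨n, n', m, m', hk, h⟩ | ⟨a, n, hk, h⟩
  · exact ⟨n, n', m, m', hk, h.outcome, (D.strict B i n n' m m' hB h hk).ge⟩
  · refine ⟨n, a + 1, B i, 0, by omega, h.outcome, ?_⟩
    linarith [D.contested_le B i a n hB h hk, hB.lt_div i]

theorem exists_le_outcome (D : UtilityDescribed v k) (hB : Admissible v k B)
    (hpos : 0 < B i + B (!i)) : ∃ n n' m m', n + n' = k ∧ Outcome (B i) (B !i) n n' m m' ∧
      utility v k B i ≤ v i * n + m := by
  rcases exists_strictOutcome_or_contested (k := k) (hB.nonneg i) (hB.nonneg _) hpos with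
    ⟨n, n', m, m', hk, h⟩ | ⟨a, n, hk, h⟩
  · exact ⟨n, n', m, m', hk, h.outcome, (D.strict B i n n' m m' hB h hk).le⟩
  · refine ⟨n + 1, a, 0, B (!i), by omega, h.outcome_succ, ?_⟩
    push_cast
    linarith [D.le_contested B i a n hB h hk, hB.lt_div i]

theorem lt_of_lt_budget (D : UtilityDescribed v k) (hk : 0 < k) (hB : Admissible v k B)
    (hpos : 0 < B i + B (!i)) {x m m' : ℝ} {n n' : ℕ}
    (h : Outcome x (B !i) n n' m m') (hn : n + n' = k) (hx : B i < x) : utility v k B i < v i * n + m := by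
  obtain ⟨n₁, n₁', m₁, m₁', hn₁, h₁, hle⟩ := D.exists_le_outcome hB hpos
  have h0 := hB.nonneg i
  refine lt_of_le_of_lt hle (add_money_lt ?_ ?_ (hB.value_pos i) (h.money_nonneg (h0.trans hx.le)))
  · exact h₁.lt_of_budget_lt h h0 (hB.nonneg _) (by omega) (by omega) hx
  · exact lt_of_le_of_lt (h₁.money_le (hB.nonneg _)) (hB.lt i)

theorem lt_of_budget_lt (D : UtilityDescribed v k) (hk : 0 < k) (hB : Admissible v k B)
    {x m m' : ℝ} {n n' : ℕ}
    (h : Outcome x (B !i) n n' m m') (hn : n + n' = k) (h0 : 0 ≤ x) (hx : x < B i) :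
    v i * n + m < utility v k B i := by
  obtain ⟨n₁, n₁', m₁, m₁', hn₁, h₁, hle⟩ :=
    D.exists_outcome_le hB (by linarith [hB.nonneg !i] : 0 < B i + B (!i))
  refine lt_of_lt_of_le (add_money_lt ?_ ?_ (hB.value_pos i) (h₁.money_nonneg (hB.nonneg i))) hle
  · exact h.lt_of_budget_lt h₁ h0 (hB.nonneg _) (by omega) (by omega) hx
  · exact lt_of_le_of_lt (h.money_le (hB.nonneg _)) (hx.trans (hB.lt i))

theorem le_of_rival_lt_budget (D : UtilityDescribed v k) (hk : 0 < k) (hB : Admissible v k B)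
    {y m m' : ℝ} {n n' : ℕ}
    (h : Outcome (B i) y n n' m m') (hn : n + n' = k) (hy0 : 0 ≤ y) (hy : y < B (!i)) :
    utility v k B i ≤ v i * n + m := by
  obtain ⟨n₁, n₁', m₁, m₁', hn₁, h₁, hle⟩ :=
    D.exists_le_outcome hB (by linarith [hB.nonneg i] : 0 < B i + B (!i))
  have h0 := hB.nonneg i
  refine hle.trans (add_money_le ?_ ?_ (hB.value_pos i) (h.money_nonneg h0))
  · exact h.le_of_rival_le h₁ h0 hy0 (by omega) (by omega) hy
  · exact lt_of_le_of_lt (h₁.money_le (hB.nonneg _)) (hB.lt i)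

theorem le_of_rival_budget_lt (D : UtilityDescribed v k) (hk : 0 < k) (hB : Admissible v k B)
    (hpos : 0 < B i + B (!i)) {y m m' : ℝ} {n n' : ℕ}
    (h : Outcome (B i) y n n' m m') (hn : n + n' = k) (hy : B (!i) < y) :
    v i * n + m ≤ utility v k B i := by
  obtain ⟨n₁, n₁', m₁, m₁', hn₁, h₁, hle⟩ := D.exists_outcome_le hB hpos
  have h0 := hB.nonneg i
  refine le_trans (add_money_le ?_ ?_ (hB.value_pos i) (h₁.money_nonneg h0)) hle
  · exact h₁.le_of_rival_le h h0 (hB.nonneg _) (by omega) (by omega) hy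
  · exact lt_of_le_of_lt (h.money_le ((hB.nonneg _).trans hy.le)) (hB.lt i)

theorem utility_lt (D : UtilityDescribed v k) (hk : 0 < k) (hB : Admissible v k B)
    (hB' : Admissible v k B') (hpos : 0 < B i + B (!i)) (h : B i < B' i) (h' : B (!i) = B' (!i)) :
    utility v k B i < utility v k B' i := by
  obtain ⟨n, n', m, m', hn, ho, hle⟩ :=
    D.exists_le_outcome hB hpos
  rw [h'] at ho
  exact lt_of_le_of_lt hle (D.lt_of_budget_lt hk hB' ho hn (hB.nonneg i) h)

theorem utility_le (D : UtilityDescribed v k) (hk : 0 < k) (hB : Admissible v k B)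
    (hB' : Admissible v k B') (hpos : 0 < B i + B (!i)) (h : B i = B' i)
    (h' : B (!i) ≤ B' (!i)) : utility v k B' i ≤ utility v k B i := by
  rcases h'.eq_or_lt with h' | h'
  · rw [agent_ext i h h']
  obtain ⟨n, n', m, m', hn, ho, hle⟩ := D.exists_outcome_le hB hpos
  rw [h] at ho
  exact (D.le_of_rival_lt_budget hk hB' ho hn (hB.nonneg _) h').trans hle

theorem winningUtility_lt (D : UtilityDescribed v k) (hk : 0 < k) (hB : Admissible v (k + 1) B)
    (hpos : 0 < B (!i)) {p q : ℝ} (hp : 0 ≤ p) (hpq : p < q) (hq : q ≤ B i) :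
    winningUtility v (utility v k) B i q < winningUtility v (utility v k) B i p := by
  have := D.utility_lt hk (hB.pay (hp.trans hpq.le) hq) (hB.pay hp (hpq.le.trans hq)) (i := i)
    (by simp; linarith) (by simpa using hpq) (by simp)
  simp only [winningUtility]
  linarith

theorem losingUtility_le (D : UtilityDescribed v k) (hk : 0 < k) (hB : Admissible v (k + 1) B)
    (hpos : 0 < B i) {p q : ℝ} (hp : 0 ≤ p) (hpq : p ≤ q) (hq : q ≤ B (!i)) :
    losingUtility (utility v k) B i p ≤ losingUtility (utility v k) B i q := by
  have h1 := pay_self B (!i) q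
  have h2 := pay_self B (!i) p
  exact D.utility_le hk (hB.pay (hp.trans hpq) hq) (hB.pay hp (hpq.trans hq)) (i := i)
    (by rw [h1, pay_not_self]; linarith) (by simp) (by rw [h1, h2]; linarith)

theorem exists_isCriticalPrice (D : UtilityDescribed v k) (hk : 0 < k)
    (hB : Admissible v (k + 1) B) (h : 0 < B i) (h' : 0 < B (!i)) :
    ∃ p, IsCriticalPrice v (utility v k) B i p := by
  refine SeqAuction.exists_isCriticalPrice (le_min h.le h'.le) fun p q hp hpq hq => ?_
  have h1 := D.winningUtility_lt hk hB h' hp hpq (hq.trans (min_le_left _ _))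
  have h2 := D.losingUtility_le hk hB h hp hpq.le (hq.trans (min_le_right _ _))
  linarith

end UtilityDescribed

end SeqAuction


/-! ### The critical price of the late winner -/

namespace SeqAuction

/-- The outcome after an agent about to win `n + 1` items has won one of them, leaving the rival
with `s`. -/
inductive AfterWin (a n : ℕ) (x y m s : ℝ) : Prop
  | poor (hn : n = 0) (hm : m = x) (hs : s = y - (a + 1) * x)
  | late (b : ℕ) (hn : n = b + 1) (h : LateOutcome a b x y m s)

theorem AfterWin.strictOutcome {a n : ℕ} {x y m s : ℝ} (h : AfterWin a n x y m s) (hs : 0 < s) :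
    StrictOutcome x y n (a + 1) m s := by
  cases h with
  | poor hn hm hs' => exact .poor hn hm (by push_cast; exact hs') hs
  | late b hn h => exact .late a b hn rfl h hs

/-- As `s < m`, the rival's final money can be raised slightly, which strictly raises her required
budget; by continuity the own budget can then be lowered. -/
theorem exists_outcome_of_lt {a n : ℕ} {x y m s t : ℝ} (h : AfterWin a n x y m s) (hx : 0 < x)
    (hy : 0 < y) (hs : 0 ≤ s) (hst : s < t) (hsm : s < m) : ∃ x' s' y' m', 0 < x' ∧ x' < x ∧
      s < s' ∧ s' < t ∧ y < y' ∧ Outcome x' y' n (a + 1) m' s' := by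
  have ha : (0 : ℝ) < a + 1 := by positivity
  cases h with
  | poor hn hm hs' =>
    have hsy : s < y := by nlinarith
    obtain ⟨s', h1, h2⟩ := exists_between (lt_min hst hsy)
    have h3 : (y - s') / (a + 1) < x := by rw [div_lt_iff₀ ha]; linarith
    obtain ⟨x', h4, h5⟩ := exists_between h3
    rw [div_lt_iff₀ ha] at h4
    have h6 := lt_min_iff.1 h2
    have hx' : 0 < x' := by
      by_contra! hneg
      nlinarith
    refine ⟨x', s', (a + 1) * x' + s', x', hx', h5, h1, h6.1, by linarith, ?_⟩
    exact .poor hn rfl (by push_cast; ring) (by linarith)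
  | late b hn h =>
    have hb : (0 : ℝ) < b + 1 := by positivity
    have hr : (0 : ℝ) < b + 2 := by positivity
    have h0 : s < x / (b + 2) := by
      rw [lt_div_iff₀ hr, h.budget_eq]; linarith
    obtain ⟨s', h1, h2⟩ := exists_between (lt_min hst h0)
    obtain ⟨h3, h4⟩ := lt_min_iff.1 h2
    rw [lt_div_iff₀ hr] at h4
    have hc : Continuous fun t => rivalBudget (a + 1) b t (t - (b + 1) * s') :=
      (rivalBudget_continuous (a + 1) b).comp
        (by fun_prop : Continuous fun t : ℝ => (t, t - (b + 1) * s'))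
    have hlt : y < rivalBudget (a + 1) b x (x - (b + 1) * s') := by
      rw [h.rival_eq]
      apply rivalBudget_strictAnti
      · have := h.budget_eq; nlinarith
      · nlinarith
    have he : ∀ᶠ t in nhds x, y < rivalBudget (a + 1) b t (t - (b + 1) * s') ∧
        s' * (b + 2) < t ∧ 0 < t :=
      (hc.continuousAt.eventually (lt_mem_nhds hlt)).and
        ((lt_mem_nhds h4).and (lt_mem_nhds hx))
    obtain ⟨x', ⟨h5, h6, h7⟩, h8⟩ :=
      ((he.filter_mono nhdsWithin_le_nhds).and (self_mem_nhdsWithin (s := Set.Iio x))).exists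
    refine ⟨x', s', _, x' - (b + 1) * s', h7, h8, h1, h3, h5, .late a b hn rfl ⟨?_, ?_, ?_, rfl⟩⟩
    · linarith
    · linarith
    · ring

namespace LateOutcome

variable {a n : ℕ} {x y m z : ℝ}

theorem le_latePrice (h : LateOutcome a n x y m z) : z ≤ latePrice a n x m := by
  rw [h.budget_eq]; exact SeqAuction.le_latePrice a n m h.nonneg

theorem rival_sub (h : LateOutcome a n x y m z) : y - latePrice a n x m = rivalBudget a n x m := by
  rw [h.rival_eq, rivalBudget_succ_eq]; ring

theorem afterLoss (h : LateOutcome a n x y m z) (hz : 0 < z) :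
    StrictOutcome x (y - latePrice a n x m) (n + 1) a m z := by
  rw [h.rival_sub]
  cases a with
  | zero =>
    have e := rivalBudget_zero_add n m h.nonneg
    rw [← h.budget_eq] at e
    rw [e]
    exact .rich rfl rfl (by rw [h.budget_eq]; push_cast; ring) (hz.trans_le h.le)
  | succ a => exact .late a n rfl rfl ⟨h.nonneg, h.le, h.budget_eq, rfl⟩ hz

theorem exists_afterLoss (h : LateOutcome a n x y m z) {z' : ℝ} (hz : 0 < z') (hlt : z' < z) :
    ∃ y' m', 0 ≤ y' ∧ y' < y - latePrice a n x m ∧ StrictOutcome x y' (n + 1) a m' z' := by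
  have hn : (0 : ℝ) < n + 1 := by positivity
  have he := h.budget_eq
  have hm : m < x - (n + 1) * z' := by nlinarith
  have hm' : z' < x - (n + 1) * z' := by linarith [h.le]
  have hx : x = x - (n + 1) * z' + (n + 1) * z' := by ring
  have h0 := mul_le_rivalBudget a n (x - (n + 1) * z') hz.le
  rw [← hx] at h0
  refine ⟨rivalBudget a n x (x - (n + 1) * z'), x - (n + 1) * z', le_trans (by positivity) h0, ?_, ?_⟩
  · rw [h.rival_sub]
    exact rivalBudget_strictAnti _ _ hm (by nlinarith)
  · cases a with
    | zero =>
      have e := rivalBudget_zero_add n (x - (n + 1) * z') hz.le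
      rw [← hx] at e
      rw [e]
      exact .rich rfl rfl (by push_cast; ring) (by linarith)
    | succ a => exact .late a n rfl rfl ⟨hz.le, hm'.le, hx, rfl⟩ hz

theorem latePrice_lt_rival (h : LateOutcome a n x y m z) (hz : 0 < z) : latePrice a n x m < y := by
  have h0 := mul_le_rivalBudget a n m hz.le
  rw [← h.budget_eq, ← h.rival_sub] at h0
  have : 0 < (a + 1) * z := by positivity
  linarith

theorem rival_pos (h : LateOutcome a n x y m z) (hz : 0 < z) : 0 < y :=
  (hz.trans_le h.le_latePrice).trans (h.latePrice_lt_rival hz)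

theorem latePrice_lt (h : LateOutcome a n x y m z) (hz : 0 < z) : latePrice a n x m < x := by
  have hy := h.rival_pos hz
  have hm := hz.trans_le h.le
  cases n with
  | zero =>
    have h1 := mul_le_rivalBudget a 0 m hz.le
    have h2 := h.budget_eq
    rw [← h2] at h1
    rw [latePrice_zero, max_lt_iff, div_lt_iff₀ (by positivity)]
    refine ⟨by linarith, ?_⟩
    have : 0 < (a + 1) * z := by positivity
    nlinarith
  | succ n =>
    by_contra! hle
    have h1 := rivalBudget_mono (a + 1) n m (sub_nonpos.2 hle)
    rw [← rivalBudget_succ_succ, ← h.rival_eq, rivalBudget_of_le _ _ le_rfl hm.le] at h1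
    linarith

/-- Winning at the indifference price either preserves `m`, and the larger price leaves the rival
with `s ≤ z`, or hits a threshold. These are the two sides of the `max` for one item, and of
comparing `x - p` with `m` otherwise. -/
theorem exists_afterWin (h : LateOutcome a n x y m z) (hz : 0 < z) :
    ∃ m₁ s, s ≤ z ∧ AfterWin a n (x - latePrice a n x m) y m₁ s ∧
      (0 < s ∧ m₁ = m ∧ (s = z → latePrice a n x m = z) ∨
        s = 0 ∧ m₁ = x - latePrice a n x m ∧ Contested a n (x - latePrice a n x m) y ∧
          x - latePrice a n x m ≤ m) := by
  have hy := h.rival_pos hz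
  have hp := sub_pos.2 (h.latePrice_lt hz)
  have hm := hz.trans_le h.le
  have hzp := h.le_latePrice
  have he := h.budget_eq
  cases n with
  | zero =>
    have hyp := h.rival_sub
    have hA := rivalBudget_mono a 0 m h.budget_le
    have hA' := rivalBudget_of_eq_mul a 0 hm.le
    have ha : (0 : ℝ) < a + 2 := by positivity
    have hmax := latePrice_zero a x m
    push_cast at he hA hA'
    rcases le_or_gt (((a + 1) * x - rivalBudget a 0 x m) / (a + 2)) (x - m) with hc | hc
    · rw [max_eq_left hc] at hmax
      rw [div_le_iff₀ ha] at hc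
      rw [hmax] at hyp
      have hxm : x - latePrice a 0 x m = m := by linarith
      rcases (show (a + 1) * m ≤ y by linarith).eq_or_lt with h0 | h0
      · refine ⟨_, 0, hz.le, .poor rfl rfl (by rw [hxm]; linarith),
          Or.inr ⟨rfl, rfl, ⟨hp, hy, ?_⟩, hxm.le⟩⟩
        rw [jumpRatio_zero_right, hxm]; push_cast; exact h0.symm
      · refine ⟨m, y - (a + 1) * m, by linarith, .poor rfl hxm.symm (by rw [hxm]),
          Or.inl ⟨by linarith, rfl, fun _ => by linarith⟩⟩
    · rw [max_eq_right hc.le] at hmax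
      rw [← hmax] at hc
      rw [eq_div_iff ha.ne'] at hmax
      have hyx : y = (a + 1) * (x - latePrice a 0 x m) := by linarith
      refine ⟨_, 0, hz.le, .poor rfl rfl (by linarith),
        Or.inr ⟨rfl, rfl, ⟨hp, hy, ?_⟩, by linarith⟩⟩
      rw [jumpRatio_zero_right]; push_cast; exact hyx
  | succ n =>
    have hn : (0 : ℝ) < n + 1 := by positivity
    have hyr := h.rival_eq
    rw [rivalBudget_succ_succ] at hyr
    push_cast at he
    rcases le_or_gt (x - latePrice a (n + 1) x m) m with hc | hc
    · have hJ : y = jumpRatio (a + 1) (n + 1) * (x - latePrice a (n + 1) x m) := by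
        rw [← rivalBudget_of_le (a + 1) n hp.le hc, ← hyr]
      refine ⟨_, 0, hz.le, .late n rfl ⟨le_rfl, hp.le, by ring, ?_⟩,
        Or.inr ⟨rfl, rfl, ⟨hp, hy, hJ⟩, hc⟩⟩
      rw [rivalBudget_of_le _ _ hp.le le_rfl, ← hJ]
    · have hle : (x - latePrice a (n + 1) x m - m) / (n + 1) ≤ z := by
        rw [div_le_iff₀ hn]; linarith
      refine ⟨m, (x - latePrice a (n + 1) x m - m) / (n + 1), hle,
        .late n rfl ⟨by apply div_nonneg <;> linarith, hle.trans h.le, by field_simp; ring, hyr⟩,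
        Or.inl ⟨div_pos (by linarith) hn, rfl, fun h => ?_⟩⟩
      rw [div_eq_iff hn.ne'] at h
      linarith

theorem not_lopsided {k : ℕ} {B : Agent → ℝ} {i : Agent}
    (h : LateOutcome a n (B i) (B !i) m z) (hk : a + n + 2 = k) : ¬ Lopsided k B := by
  subst hk
  have hx := h.budget_nonneg
  have hy : 0 ≤ B (!i) := by have := h.mul_le_rival; have := h.nonneg; nlinarith
  rw [lopsided_iff i, not_or, not_lt, not_lt]
  push_cast
  constructor
  · have h1 := h.mul_rival_le
    have h2 : ((n : ℝ) + 2) * B (!i) ≤ (n + 2) * ((a + n + 2) * B i) := by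
      refine h1.trans ?_
      rw [← mul_assoc]
      gcongr
      nlinarith [(Nat.cast_nonneg n : (0 : ℝ) ≤ n), (Nat.cast_nonneg a : (0 : ℝ) ≤ a),
        mul_nonneg (Nat.cast_nonneg (α := ℝ) n) (Nat.cast_nonneg (α := ℝ) a)]
    exact le_of_mul_le_mul_left h2 (by positivity)
  · have h1 := h.jumpRatio_mul_le_rival
    have h2 := jumpRatio_dual a (n + 1)
    have h3 := jumpRatio_le (n + 1 + 1) a
    have h4 := jumpRatio_nonneg (n + 1 + 1) a
    push_cast at h3
    calc B i = jumpRatio (n + 1 + 1) a * (jumpRatio (a + 1) (n + 1) * B i) := by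
          rw [← mul_assoc, mul_comm (jumpRatio _ a), h2, one_mul]
      _ ≤ jumpRatio (n + 1 + 1) a * B (!i) := by gcongr
      _ ≤ (n + 1 + 1 + a) * B (!i) := by gcongr
      _ = _ := by ring

end LateOutcome

variable {v B : Agent → ℝ} {k : ℕ} {i : Agent} {a n : ℕ} {m z : ℝ}

/-- If winning leads to a contested item, a slightly higher price loses that item and leaves less
than `m`, while a lower price secures it; otherwise both options have equal utility at this price.
-/
theorem UtilityDescribed.isCriticalPrice_latePrice (D : UtilityDescribed v k)
    (hk : a + n + 1 = k) (hB : Admissible v (k + 1) B)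
    (h : LateOutcome a n (B i) (B !i) m z) (hz : 0 < z) :
    IsCriticalPrice v (utility v k) B i (latePrice a n (B i) m) := by
  have hk0 : 0 < k := by omega
  have hp0 := hz.le.trans h.le_latePrice
  have hpx := (h.latePrice_lt hz).le
  have hpy := (h.latePrice_lt_rival hz).le
  have hx := hp0.trans_lt (h.latePrice_lt hz)
  have hy := h.rival_pos hz
  have hW := hB.pay hp0 hpx
  have hL := hB.pay hp0 hpy
  have eL : losingUtility (utility v k) B i (latePrice a n (B i) m) = v i * (n + 1) + m := by
    have := D.strict _ i _ _ _ _ hL (by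
      rw [pay_self B (!i), pay_not_self]; exact h.afterLoss hz) (by omega)
    push_cast at this
    exact this
  have hv := hB.value_pos i
  have hmv : m < v i := h.le_budget.trans_lt (hB.lt i)
  refine ⟨⟨hp0, le_min hpx hpy⟩, fun q hq hlt => ?_, fun q hq hlt => ?_⟩
  · have hqx := hq.2.trans (min_le_left _ _)
    have hqy := hq.2.trans (min_le_right _ _)
    refine lt_of_lt_of_le ?_ (D.losingUtility_le hk0 hB hx hp0 hlt.le hqy)
    rw [eL]
    obtain ⟨m₁, s, hs, hA, ⟨hs0, rfl, -⟩ | ⟨rfl, rfl, hc, hle⟩⟩ := h.exists_afterWin hz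
    · have := D.strict _ i _ _ _ _ hW (by simpa using hA.strictOutcome hs0) (by omega)
      have h2 := D.winningUtility_lt hk0 hB hy hp0 hlt hqx
      simp only [winningUtility] at h2 ⊢
      linarith
    · have := D.lt_of_lt_budget hk0 (hB.pay hq.1 hqx) (i := i) (by simp; linarith)
        (by simpa using hc.outcome) (by omega) (by simpa using hlt)
      simp only [winningUtility]
      linarith
  · have hqx := hq.2.trans (min_le_left _ _)
    refine lt_of_le_of_lt (D.losingUtility_le hk0 hB hx hq.1 hlt.le hpy) ?_
    rw [eL]
    obtain ⟨m₁, s, hs, hA, ⟨hs0, rfl, -⟩ | ⟨rfl, rfl, hc, hle⟩⟩ := h.exists_afterWin hz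
    · have := D.strict _ i _ _ _ _ hW (by simpa using hA.strictOutcome hs0) (by omega)
      have h2 := D.winningUtility_lt hk0 hB hy hq.1 hlt hpx
      simp only [winningUtility] at h2 ⊢
      linarith
    · have := D.lt_of_budget_lt hk0 (hB.pay hq.1 hqx) (i := i)
        (by simpa using hc.outcome_succ) (by omega) hc.pos.le (by simpa using hlt)
      simp only [winningUtility]
      push_cast at this
      linarith

end SeqAuction


/-! ### The rival's critical price, contested rounds and the induction -/

namespace SeqAuction

variable {v B : Agent → ℝ} {k : ℕ} {i : Agent} {a n : ℕ} {m z : ℝ}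

theorem losingUtility_not (u : (Agent → ℝ) → Agent → ℝ) (B : Agent → ℝ) (i : Agent) (p : ℝ) :
    losingUtility u B (!i) p = u (pay B i p) (!i) := by
  simp [losingUtility]

theorem UtilityDescribed.latePrice_le (D : UtilityDescribed v k)
    (hk : a + n + 1 = k) (hB : Admissible v (k + 1) B)
    (h : LateOutcome a n (B i) (B !i) m z) (hz : 0 < z) {p : ℝ}
    (hp : IsCriticalPrice v (utility v k) B (!i) p) : latePrice a n (B i) m ≤ p := by
  have hp0 := hz.le.trans h.le_latePrice
  have hpx := (h.latePrice_lt hz).le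
  have hpy := (h.latePrice_lt_rival hz).le
  have hW := hB.pay hp0 hpx
  have hL := hB.pay hp0 hpy
  refine hp.le_of_le ⟨hp0, le_min hpy (by simpa using hpx)⟩ ?_
  have eW := D.strict _ (!i) _ _ _ _ hL (by simpa using (h.afterLoss hz).symm) (by omega)
  rw [losingUtility_not, winningUtility, eW]
  obtain ⟨m₁, s, hs, hA, ⟨hs0, rfl, -⟩ | ⟨rfl, rfl, hc, hle⟩⟩ := h.exists_afterWin hz
  · have := D.strict _ (!i) _ _ _ _ hW (by simpa using (hA.strictOutcome hs0).symm) (by omega)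
    rw [this]
    push_cast
    linarith
  · have := D.le_contested _ (!i) n a hW (by simpa using hc.symm) (by omega)
    have := hW.lt_div (!i)
    linarith

/-- If winning left the rival with `s < z`, she would still prefer winning slightly above the price,
by perturbing both continuations. -/
theorem UtilityDescribed.eq_of_isCriticalPrice_latePrice (D : UtilityDescribed v k)
    (hk : a + n + 1 = k) (hB : Admissible v (k + 1) B)
    (h : LateOutcome a n (B i) (B !i) m z) (hz : 0 < z)
    (hp : IsCriticalPrice v (utility v k) B (!i) (latePrice a n (B i) m)) :
    AfterWin a n (B i - latePrice a n (B i) m) (B !i) m z ∧ latePrice a n (B i) m = z := by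
  have hk0 : 0 < k := by omega
  have hp0 := hz.le.trans h.le_latePrice
  have hpx := h.latePrice_lt hz
  have hpy := h.latePrice_lt_rival hz
  have hx := hp0.trans_lt hpx
  have hy := h.rival_pos hz
  obtain ⟨m₁, s, hs, hA, hc⟩ := h.exists_afterWin hz
  rcases hs.eq_or_lt with rfl | hs
  · rcases hc with ⟨-, rfl, hc⟩ | ⟨h0, -⟩
    · exact ⟨hA, hc rfl⟩
    · exact absurd h0 hz.ne'
  exfalso
  have hs0 : 0 ≤ s := by
    rcases hc with hc | hc
    exacts [hc.1.le, hc.1.ge]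
  have hsm : s < m₁ := by
    rcases hc with ⟨-, rfl, -⟩ | ⟨rfl, rfl, -⟩
    exacts [hs.trans_le h.le, by linarith]
  obtain ⟨x', s', y', m', hx'0, hx', hss', hs'z, hy', hO⟩ :=
    exists_outcome_of_lt hA (by linarith) hy hs0 hs hsm
  obtain ⟨z', hz', hz'z⟩ := exists_between hs'z
  obtain ⟨y₁, m₂, hy₁, hy₁', hO'⟩ := h.exists_afterLoss (by linarith) hz'z
  -- This price exceeds the critical one, but both perturbed bounds still apply: losing is worth
  -- less than `s'`, winning at least `z' > s'`, besides the same `a + 1` items.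
  set q := min (B i - x') (B (!i) - y₁) with hq
  have hq1 : q ≤ B i - x' := min_le_left _ _
  have hq2 : q ≤ B (!i) - y₁ := min_le_right _ _
  have hpq : latePrice a n (B i) m < q := lt_min (by linarith) (by linarith)
  have hq0 : 0 ≤ q := hp0.trans hpq.le
  have hcrit := hp.2.1 q ⟨hq0, le_min (by linarith) (by rw [Bool.not_not]; linarith)⟩ hpq
  have hL : losingUtility (utility v k) B (!i) q < v (!i) * (a + 1) + s' := by
    have h1 := D.losingUtility_le hk0 hB hy hq0 hq1 (by simp only [Bool.not_not]; linarith)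
    have h2 := D.lt_of_lt_budget hk0 (hB.pay (hq0.trans hq1) (by linarith : B i - x' ≤ B i))
      (i := !i) (x := y') (n := a + 1) (n' := n) (m := s') (m' := m') (by simp; linarith)
      (by simpa using hO.symm) (by omega) (by simpa using hy')
    rw [losingUtility_not _ _ _ (B i - x')] at h1
    push_cast at h2
    linarith
  have hW : v (!i) * (a + 1) + z' ≤ winningUtility v (utility v k) B (!i) q := by
    have hadm := hB.pay hq0 (by linarith : q ≤ B (!i))
    rw [winningUtility]
    rcases hq2.eq_or_lt with heq | hlt
    · have := D.strict _ (!i) a (n + 1) z' m₂ hadm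
        (by simpa [heq] using hO'.symm) (by omega)
      linarith
    · have := D.lt_of_budget_lt hk0 hadm (i := !i) (x := y₁) (n := a) (n' := n + 1) (m := z')
        (m' := m₂) (by simpa using hO'.outcome.symm) (by omega) hy₁ (by simp; linarith)
      linarith
  linarith

/-- The canonical bids and the outcome of the current round in a generic situation. -/
theorem UtilityDescribed.canonicalBids_late (D : UtilityDescribed v k)
    (hk : a + n + 1 = k) (hB : Admissible v (k + 1) B)
    (h : LateOutcome a n (B i) (B !i) m z) (hz : 0 < z) :
    ∃ r, canonicalBids v (utility v k) (k + 1) B = thresholdBids r ∧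
      r i = latePrice a n (B i) m ∧ (r i < r (!i) ∨ r i = r (!i) ∧
        AfterWin a n (B i - latePrice a n (B i) m) (B !i) m z ∧ latePrice a n (B i) m = z) := by
  have hx := (hz.le.trans h.le_latePrice).trans_lt (h.latePrice_lt hz)
  have hy := h.rival_pos hz
  obtain ⟨p, hp⟩ := D.exists_isCriticalPrice (by omega) hB (i := !i) hy (by simpa using hx)
  have hr := (D.isCriticalPrice_latePrice hk hB h hz).criticalPrice_eq
  refine ⟨_, canonicalBids_of_not_lopsided (by omega) (h.not_lopsided (by omega)), hr, ?_⟩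
  rw [hr, hp.criticalPrice_eq]
  rcases (D.latePrice_le hk hB h hz hp).eq_or_lt with heq | hlt
  · exact Or.inr ⟨heq, D.eq_of_isCriticalPrice_latePrice hk hB h hz (by rwa [heq])⟩
  · exact Or.inl hlt

/-- In a tie both results of the coin give each agent the same utility, so averaging changes
nothing. -/
theorem UtilityDescribed.utility_late (D : UtilityDescribed v k)
    (hk : a + n + 1 = k) (hB : Admissible v (k + 1) B)
    (h : LateOutcome a n (B i) (B !i) m z) (hz : 0 < z) :
    utility v (k + 1) B i = v i * (n + 1) + m ∧
      utility v (k + 1) B (!i) = v (!i) * (a + 1) + z := by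
  have hp0 := hz.le.trans h.le_latePrice
  have hpx := (h.latePrice_lt hz).le
  have hpy := (h.latePrice_lt_rival hz).le
  have hW := hB.pay hp0 hpx
  have hL := hB.pay hp0 hpy
  obtain ⟨r, hb, hr, hlt⟩ := D.canonicalBids_late hk hB h hz
  have e1 : losingUtility (utility v k) B i (r i) = v i * (n + 1) + m := by
    rw [losingUtility, hr, D.strict _ i _ _ _ _ hL (by simpa using h.afterLoss hz) (by omega)]
    push_cast; ring
  have e2 : winningUtility v (utility v k) B (!i) (r i) = v (!i) * (a + 1) + z := by
    rw [winningUtility, hr,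
      D.strict _ (!i) _ _ _ _ hL (by simpa using (h.afterLoss hz).symm) (by omega)]
    ring
  rcases hlt with hlt | ⟨heq, hA, -⟩
  · rw [utility_succ_loser hb hlt, e1, utility_succ_winner hb (by simpa using hlt), Bool.not_not, e2]
    exact ⟨rfl, rfl⟩
  · have e3 : winningUtility v (utility v k) B i (r i) = v i * (n + 1) + m := by
      rw [winningUtility, hr,
        D.strict _ i _ _ _ _ hW (by simpa using hA.strictOutcome hz) (by omega)]
      ring
    have e4 : losingUtility (utility v k) B (!i) (r i) = v (!i) * (a + 1) + z := by
      rw [losingUtility_not, hr,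
        D.strict _ (!i) _ _ _ _ hW (by simpa using (hA.strictOutcome hz).symm) (by omega)]
      push_cast; ring
    rw [utility_succ_tie hb heq, utility_succ_tie (i := !i) hb (by simpa using heq.symm), ← heq,
      e1, e2, e3, e4]
    constructor <;> ring

theorem UtilityDescribed.utility_of_lopsided (D : UtilityDescribed v k) (hB : Admissible v (k + 1) B)
    (h : ((k + 1 : ℕ) : ℝ) * B i < B (!i)) :
    utility v (k + 1) B i = B i ∧
      utility v (k + 1) B (!i) = v (!i) * (k + 1) + (B (!i) - (k + 1) * B i) := by
  have hx := hB.nonneg i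
  push_cast at h
  have hlt : B i < B (!i) := by
    have : 0 ≤ k * B i := by positivity
    linarith
  have hb := canonicalBids_of_lopsided (v := v) (u := utility v k) (k := k + 1) (B := B)
    (Or.inr ((lopsided_iff i).2 (Or.inl (by push_cast; exact h))))
  have hL := hB.pay hx hlt.le
  have hS : StrictOutcome (B i) (B (!i) - B i) 0 k (B i) (B (!i) - B i - k * B i) :=
    .poor rfl rfl rfl (by linarith)
  rw [utility_succ_loser hb hlt, utility_succ_winner hb (by simpa using hlt), Bool.not_not,
    losingUtility, winningUtility, D.strict _ i _ _ _ _ hL (by simpa using hS) (by omega),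
    D.strict _ (!i) _ _ _ _ hL (by simpa using hS.symm) (by omega)]
  push_cast
  constructor <;> ring

section Contested

variable {x y : ℝ}

theorem jumpRatio_le_succ_left (a n : ℕ) : jumpRatio a n ≤ jumpRatio (a + 1) n := by
  cases n with
  | zero => rw [jumpRatio_zero_right, jumpRatio_zero_right]; push_cast; linarith
  | succ n =>
    have h := le_latePrice a n 1 le_rfl
    rw [mul_zero, add_zero, latePrice_self _ _ zero_le_one] at h
    linarith

/-- For positive `n` this is monotonicity of `latePrice` at `x = m = 1`. -/
theorem jumpRatio_convex (a n : ℕ) :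
    jumpRatio (a + 1) n - jumpRatio a n ≤ jumpRatio (a + 2) n - jumpRatio (a + 1) n := by
  cases n with
  | zero =>
    simp only [jumpRatio_zero_right]
    push_cast
    linarith
  | succ n =>
    have h := latePrice_le_latePrice_succ a n 1 1
    rw [latePrice_self _ _ zero_le_one, latePrice_self _ _ zero_le_one] at h
    linarith

namespace Contested

/-- The price at which the contested item is sold. -/
theorem sub_eq (h : Contested a n x y) :
    x - (y - jumpRatio a n * x) = jumpRatio n a * y := by
  rw [h.eq]
  cases n with
  | zero => simp only [jumpRatio_zero_left, jumpRatio_zero_right]; push_cast; ring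
  | succ n =>
    have h1 := jumpRatio_dual a n
    have h2 := jumpRatio_recurrence a n
    have h3 := jumpRatio_pos a n
    have h4 : (x - (jumpRatio (a + 1) (n + 1) * x - jumpRatio a (n + 1) * x)) *
        jumpRatio (a + 1) n = jumpRatio (n + 1) a * (jumpRatio (a + 1) (n + 1) * x) *
          jumpRatio (a + 1) n := by
      linear_combination (-x) * h2 - jumpRatio (a + 1) (n + 1) * x * h1
    exact mul_right_cancel₀ h3.ne' h4

theorem price_nonneg (h : Contested a n x y) : 0 ≤ y - jumpRatio a n * x := by
  rw [h.eq, ← sub_mul]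
  exact mul_nonneg (sub_nonneg.2 (jumpRatio_le_succ_left a n)) h.pos.le

theorem price_le_rival (h : Contested a n x y) : y - jumpRatio a n * x ≤ y := by
  have := mul_nonneg (jumpRatio_nonneg a n) h.pos.le
  linarith

theorem price_symm (h : Contested a n x y) :
    x - jumpRatio n a * y = y - jumpRatio a n * x := by
  rw [← h.sub_eq]; ring

theorem price_le (h : Contested a n x y) : y - jumpRatio a n * x ≤ x := by
  rw [← h.price_symm]; exact h.symm.price_le_rival

theorem afterLoss (h : Contested (a + 1) n x y) :
    Contested a n x (y - (y - jumpRatio (a + 1) n * x)) :=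
  ⟨h.pos, by rw [sub_sub_cancel]; exact mul_pos (jumpRatio_pos _ _) h.pos, by ring⟩

theorem afterWin (h : Contested a (n + 1) x y) :
    Contested a n (x - (y - jumpRatio a (n + 1) * x)) y := by
  have := h.symm.afterLoss.symm
  rwa [h.price_symm] at this

theorem not_lopsided (h : Contested a n (B i) (B !i)) (hk : a + n + 1 = k) : ¬ Lopsided k B := by
  subst hk
  have key : ∀ {a n x y}, Contested a n x y → y ≤ (a + n + 1) * x := by
    intro a n x y h
    have := mul_le_mul_of_nonneg_right (jumpRatio_le (a + 1) n) h.pos.le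
    rw [h.eq]
    push_cast at this
    linarith
  rw [lopsided_iff i, not_or, not_lt, not_lt]
  push_cast
  exact ⟨key h, by linarith [key h.symm]⟩

end Contested

theorem UtilityDescribed.isCriticalPrice_contested (D : UtilityDescribed v k) (hk0 : 0 < k)
    (hk : a + n = k) (hB : Admissible v (k + 1) B) (h : Contested a n (B i) (B !i)) :
    IsCriticalPrice v (utility v k) B i (B (!i) - jumpRatio a n * B i) := by
  have hp0 := h.price_nonneg
  have hpy := h.price_le_rival
  have hpx := h.price_le
  have hv := hB.value_pos i
  have hxv := hB.lt i
  refine ⟨⟨hp0, le_min hpx hpy⟩, fun q hq hlt => ?_, fun q hq hlt => ?_⟩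
  · have hqx := hq.2.trans (min_le_left _ _)
    have hqy := hq.2.trans (min_le_right _ _)
    have h1 : winningUtility v (utility v k) B i q < v i * (n + 1) := by
      cases n with
      | zero =>
        have := h.sub_eq
        rw [jumpRatio_zero_left] at this
        linarith
      | succ n =>
        have hc := h.afterWin
        have := D.lt_of_lt_budget hk0 (hB.pay hq.1 hqx) (i := i)
          (by simp; linarith [h.rival_pos]) (by simpa using hc.outcome) (by omega)
          (by simpa using hlt)
        rw [winningUtility]
        push_cast
        nlinarith
    have h2 : v i * (n + 1) ≤ losingUtility (utility v k) B i q := by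
      cases a with
      | zero =>
        rw [jumpRatio_zero_left] at hlt
        linarith
      | succ a =>
        have hc := h.afterLoss
        have := D.le_of_rival_budget_lt hk0 (hB.pay hq.1 hqy) (i := i)
          (by rw [pay_not_self, pay_self]; linarith [h.pos])
          (by simpa using hc.outcome_succ) (by omega) (by rw [pay_self B (!i)]; linarith)
        rw [losingUtility]
        push_cast at this
        linarith
    linarith
  · have hqx := hq.2.trans (min_le_left _ _)
    have hqy := hq.2.trans (min_le_right _ _)
    have h1 : v i * (n + 1) < winningUtility v (utility v k) B i q := by
      have hO := (outcome_of_eq_jumpRatio_mul n a h.rival_pos.le h.sub_eq).symm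
      have := D.lt_of_budget_lt hk0 (hB.pay hq.1 hqx) (i := i)
        (by simpa using hO) (by omega) (by linarith) (by simpa using hlt)
      rw [winningUtility]
      linarith
    have h2 : losingUtility (utility v k) B i q ≤ v i * n + B i := by
      have hO := outcome_of_eq_jumpRatio_mul a n h.pos.le
        (sub_sub_cancel (B !i) (jumpRatio a n * B i))
      refine D.le_of_rival_lt_budget hk0 (hB.pay hq.1 hqy) (i := i) (by simpa using hO) (by omega)
        (by linarith) ?_
      rw [pay_self B (!i)]
      linarith
    linarith

/-- The canonical bids if an item is contested: the two agents bid the same. -/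
theorem UtilityDescribed.canonicalBids_contested (D : UtilityDescribed v k)
    (hk : a + n = k) (hB : Admissible v (k + 1) B) (h : Contested a n (B i) (B !i)) :
    ∃ r, canonicalBids v (utility v k) (k + 1) B = thresholdBids r ∧
      r i = B (!i) - jumpRatio a n * B i ∧ r i = r (!i) := by
  rcases Nat.eq_zero_or_pos k with hk0 | hk0
  · obtain ⟨rfl, rfl⟩ : a = 0 ∧ n = 0 := by omega
    have := h.eq
    rw [jumpRatio_zero_right] at this
    refine ⟨B, canonicalBids_of_lopsided (Or.inl (by omega)), ?_, ?_⟩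
    · rw [jumpRatio_zero_left, this]; simp
    · rw [this]; simp
  · refine ⟨_, canonicalBids_of_not_lopsided (by omega) (h.not_lopsided (by omega)), ?_⟩
    have h2 := (D.isCriticalPrice_contested hk0 (i := !i) (a := n) (n := a) (by omega) hB
      (by simpa using h.symm)).criticalPrice_eq
    rw [(D.isCriticalPrice_contested hk0 hk hB h).criticalPrice_eq, h2, Bool.not_not, h.price_symm]
    exact ⟨rfl, rfl⟩

/-- Averaging over the fair coin at most halves the margin `v i / 2 ^ k` available one round later.
-/
theorem UtilityDescribed.utility_contested (D : UtilityDescribed v k)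
    (hk : a + n = k) (hB : Admissible v (k + 1) B) (h : Contested a n (B i) (B !i)) :
    v i * n + v i / 2 ^ (k + 1) ≤ utility v (k + 1) B i ∧
      utility v (k + 1) B i ≤ v i * (n + 1) - v i / 2 ^ (k + 1) + B i := by
  obtain ⟨r, hb, hr, heq⟩ := D.canonicalBids_contested hk hB h
  have hp0 := h.price_nonneg
  have hW := hB.pay hp0 h.price_le
  have hL := hB.pay hp0 h.price_le_rival
  have hv := hB.value_pos i
  have hx := hB.nonneg i
  rw [utility_succ_tie hb heq, hr]
  set p := B (!i) - jumpRatio a n * B i with hp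
  have hd : v i / 2 ^ (k + 1) = v i / 2 ^ k / 2 := by rw [pow_succ, div_div]
  have hd0 : 0 < v i / 2 ^ k := by positivity
  have hd1 : v i / 2 ^ k ≤ v i := div_le_self hv.le (one_le_pow₀ (by norm_num))
  have hL' : v i * n ≤ losingUtility (utility v k) B i p ∧
      losingUtility (utility v k) B i p ≤ v i * (n + 1) - v i / 2 ^ k + B i := by
    rw [losingUtility]
    cases a with
    | zero =>
      have hy : B (!i) - p = 0 := by rw [hp, jumpRatio_zero_left]; ring
      have := D.strict _ i n 0 (B i) 0 hL
        (by rw [pay_self B (!i), pay_not_self, hy]; exact .rich rfl rfl (by ring) h.pos) (by omega)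
      constructor <;> linarith
    | succ a =>
      have hc : Contested a n (pay B (!i) p i) (pay B (!i) p (!i)) := by
        rw [pay_not_self, pay_self B (!i)]; exact h.afterLoss
      have h1 := D.contested_le _ i a n hL hc (by omega)
      have h2 := D.le_contested _ i a n hL hc (by omega)
      rw [pay_not_self] at h2
      exact ⟨by linarith, h2⟩
  -- The upper bound concerns the sum: for `n = 0`, winning yields the contested item for sure, and
  -- only losing leaves a margin.
  have hW' : v i * n + v i / 2 ^ k ≤ winningUtility v (utility v k) B i p ∧
      winningUtility v (utility v k) B i p + losingUtility (utility v k) B i p ≤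
        2 * (v i * (n + 1) + B i) - v i / 2 ^ k := by
    rw [winningUtility]
    cases n with
    | zero =>
      have hx : B i - p = 0 := by rw [hp, h.sub_eq, jumpRatio_zero_left]; ring
      have := D.strict _ i 0 k 0 (B (!i)) hW
        (by rw [pay_self, pay_rival, hx]; exact .poor rfl rfl (by ring) h.rival_pos) (by omega)
      push_cast at *
      constructor <;> linarith
    | succ n =>
      have hc : Contested a n (pay B i p i) (pay B i p (!i)) := by
        rw [pay_self, pay_rival]; exact h.afterWin
      have h1 := D.contested_le _ i a n hW hc (by omega)
      have h2 := D.le_contested _ i a n hW hc (by omega)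
      rw [pay_self] at h2
      push_cast at *
      constructor <;> linarith
  constructor <;> linarith

end Contested

theorem utilityDescribed (v : Agent → ℝ) (k : ℕ) : UtilityDescribed v k := by
  induction k with
  | zero =>
    refine ⟨fun B i n n' m m' hB h hn => ?_, fun B i a n hB h hn => by omega,
      fun B i a n hB h hn => by omega⟩
    obtain ⟨rfl, rfl⟩ : n = 0 ∧ n' = 0 := by omega
    cases h with
    | poor hn hm hm' h => simp [utility, hm]
    | rich hn hm hm' h => simp [utility, hm']
    | late => omega
    | early => omega
  | succ k D =>
    refine ⟨fun B i n n' m m' hB h hn => ?_,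
      fun B i a n hB h hn => (D.utility_contested (by omega) hB h).1,
      fun B i a n hB h hn => (D.utility_contested (by omega) hB h).2⟩
    cases h with
    | poor hn0 hm hm' h =>
      obtain rfl : n' = k + 1 := by omega
      rw [(D.utility_of_lopsided hB (by linarith)).1, hn0, hm]
      simp
    | rich hn0 hm' hm h =>
      obtain rfl : n = k + 1 := by omega
      have := (D.utility_of_lopsided (i := !i) hB (by rw [Bool.not_not]; linarith)).2
      rw [Bool.not_not] at this
      rw [this, hm]
      push_cast; ring
    | late a b hn0 hn' h hz =>
      subst hn0 hn'
      rw [(D.utility_late (by omega) hB h hz).1]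
      push_cast; ring
    | early a b hn0 hn' h hz =>
      subst hn0 hn'
      have := (D.utility_late (i := !i) (a := b) (n := a) (by omega) hB (by simpa using h) hz).2
      rw [Bool.not_not] at this
      rw [this]
      push_cast; ring

end SeqAuction


/-! ### Prices along the canonical play -/

namespace SeqAuction

/-- The price paid in the current round of the canonical outcome with `k + 1` items. -/
noncomputable def roundPrice (v : Agent → ℝ) (k : ℕ) (B : Agent → ℝ) : ℝ :=
  (canonicalBids v (utility v k) (k + 1) B true).amount

variable {v B : Agent → ℝ} {k : ℕ} {i : Agent} {a n : ℕ} {m z : ℝ}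

theorem roundPrice_eq {r : Agent → ℝ}
    (h : canonicalBids v (utility v k) (k + 1) B = thresholdBids r) (i : Agent) :
    roundPrice v k B = min (r i) (r (!i)) := by
  rw [roundPrice, h, thresholdBids_amount]
  cases i <;> simp [min_comm]

theorem canonicalBids_amount (w : Agent) :
    (canonicalBids v (utility v k) (k + 1) B w).amount = roundPrice v k B := by
  obtain ⟨r, hr⟩ : ∃ r, canonicalBids v (utility v k) (k + 1) B = thresholdBids r := by
    unfold canonicalBids
    split_ifs
    exacts [⟨_, rfl⟩, ⟨_, rfl⟩]
  rw [roundPrice_eq hr w, hr, thresholdBids_amount]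

theorem isCriticalPrice_zero {u : (Agent → ℝ) → Agent → ℝ} (hB : ∀ i, B i = 0) :
    IsCriticalPrice v u B i 0 := by
  rw [IsCriticalPrice, hB, hB, min_self]
  exact ⟨⟨le_rfl, le_rfl⟩, fun q hq h => absurd hq.2 h.not_ge, fun q hq h => absurd hq.1 h.not_ge⟩

theorem roundPrice_of_zero (hB : ∀ i, B i = 0) : roundPrice v k B = 0 := by
  by_cases hk : k + 1 = 1
  · rw [roundPrice_eq (canonicalBids_of_lopsided (Or.inl hk)) true, hB, hB, min_self]
  · have hl : ¬ Lopsided (k + 1) B := by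
      rintro ⟨i, hi⟩
      simp [hB] at hi
    rw [roundPrice_eq (canonicalBids_of_not_lopsided hk hl) true,
      (isCriticalPrice_zero hB).criticalPrice_eq, (isCriticalPrice_zero hB).criticalPrice_eq,
      min_self]

theorem roundPrice_of_lopsided (hx : 0 ≤ B i) (h : (k + 1) * B i < B (!i)) :
    roundPrice v k B = B i ∧ winners (canonicalBids v (utility v k) (k + 1) B) = {!i} := by
  have hlt : B i < B (!i) := by
    have : 0 ≤ k * B i := by positivity
    linarith
  have hb := canonicalBids_of_lopsided (v := v) (u := utility v k) (k := k + 1) (B := B)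
    (Or.inr ((lopsided_iff i).2 (Or.inl (by push_cast; exact h))))
  rw [roundPrice_eq hb i, hb, winners_thresholdBids_of_lt hlt, min_eq_left hlt.le]
  exact ⟨rfl, rfl⟩

theorem roundPrice_of_late (hk : a + n + 1 = k) (hB : Admissible v (k + 1) B)
    (h : LateOutcome a n (B i) (B !i) m z) (hz : 0 < z) :
    roundPrice v k B = latePrice a n (B i) m := by
  obtain ⟨r, hb, hr, hlt⟩ := (utilityDescribed v k).canonicalBids_late hk hB h hz
  rw [roundPrice_eq hb i, ← hr, min_eq_left]
  rcases hlt with hlt | hlt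
  exacts [hlt.le, hlt.1.le]

theorem roundPrice_of_contested (hk : a + n = k) (hB : Admissible v (k + 1) B)
    (h : Contested a n (B i) (B !i)) : roundPrice v k B = B (!i) - jumpRatio a n * B i := by
  obtain ⟨r, hb, hr, heq⟩ := (utilityDescribed v k).canonicalBids_contested hk hB h
  rw [roundPrice_eq hb i, ← heq, min_self, hr]

/-- The next price after the rival of an agent has won a contested item. -/
theorem roundPrice_pay_contested (hk : a + n = k + 1) (hB : Admissible v (k + 2) B)
    (h : Contested a n (B i) (B !i)) :
    roundPrice v k (pay B (!i) (B (!i) - jumpRatio a n * B i)) ≤ B (!i) - jumpRatio a n * B i := by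
  have hp := h.price_nonneg
  have hL := hB.pay hp h.price_le_rival
  cases a with
  | zero =>
    rw [jumpRatio_zero_left, zero_mul, sub_zero] at *
    rw [(roundPrice_of_lopsided (i := !i) (by simp) (by simpa using h.pos)).1]
    simpa using hp
  | succ a =>
    have hc : Contested a n (pay B (!i) (B (!i) - jumpRatio (a + 1) n * B i) i)
        (pay B (!i) (B (!i) - jumpRatio (a + 1) n * B i) (!i)) := by
      rw [pay_not_self, pay_self B (!i)]; exact h.afterLoss
    rw [roundPrice_of_contested (by omega) hL hc, pay_not_self, pay_self B (!i), h.eq]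
    nlinarith [mul_le_mul_of_nonneg_right (jumpRatio_convex a n) h.pos.le]

/-- The next price after the early winner has won an item. -/
theorem roundPrice_pay_rival_late (hk : a + n + 1 = k + 1) (hB : Admissible v (k + 2) B)
    (h : LateOutcome a n (B i) (B !i) m z) (hz : 0 < z) :
    roundPrice v k (pay B (!i) (latePrice a n (B i) m)) ≤ latePrice a n (B i) m := by
  have hL := hB.pay (hz.le.trans h.le_latePrice) (h.latePrice_lt_rival hz).le
  have hm := hz.trans_le h.le
  have hS := h.rival_sub
  cases a with
  | zero =>
    have e := rivalBudget_zero_add n m h.nonneg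
    rw [← h.budget_eq, ← hS] at e
    have hnk : n = k := by omega
    rw [(roundPrice_of_lopsided (i := !i) (by rw [pay_self, e]; exact hz.le) ?_).1, pay_self, e]
    · exact h.le_latePrice
    · rw [pay_self, e, Bool.not_not, pay_not_self, ← hnk, h.budget_eq]
      linarith
  | succ a =>
    have hc : LateOutcome a n (pay B (!i) (latePrice (a + 1) n (B i) m) i)
        (pay B (!i) (latePrice (a + 1) n (B i) m) (!i)) m z := by
      rw [pay_not_self, pay_self B (!i)]
      exact ⟨h.nonneg, h.le, h.budget_eq, hS⟩
    rw [roundPrice_of_late (by omega) hL hc hz, pay_not_self]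
    exact latePrice_le_latePrice_succ a n _ _

/-- The next price after the late winner has won an item, which may happen if both agents bid the
price that remains until the end. -/
theorem roundPrice_pay_late (hk : a + n + 1 = k + 1) (hB : Admissible v (k + 2) B)
    (h : LateOutcome a n (B i) (B !i) m z) (hz : 0 < z)
    (hA : AfterWin a n (B i - latePrice a n (B i) m) (B !i) m z)
    (hpz : latePrice a n (B i) m = z) :
    roundPrice v k (pay B i (latePrice a n (B i) m)) ≤ latePrice a n (B i) m := by
  have hW := hB.pay (hz.le.trans h.le_latePrice) (h.latePrice_lt hz).le
  have hm := hz.trans_le h.le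
  have hS := h.rival_sub
  have hbud := h.budget_eq
  cases hA with
  | poor hn hmx hs =>
    subst hn
    have hak : a = k := by omega
    push_cast at hbud
    rw [(roundPrice_of_lopsided (i := i) (by rw [pay_self, ← hmx]; exact hm.le) ?_).1, pay_self,
      ← hmx, hpz]
    -- The next price is `m`, so `m = z` is needed. If `z < m`, then `B i < 2 * m`, and
    -- `rivalBudget` would be below its balanced value `(a + 1) * m`, contrary to the rival's
    -- budget.
    · by_contra! hlt
      rw [hpz] at hS
      rw [← hmx] at hs
      cases a with
      | zero =>
        have e := rivalBudget_zero_add 0 m h.nonneg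
        push_cast at e hs
        rw [← hbud] at e
        linarith
      | succ a =>
        have e := rivalBudget_of_eq_mul (a + 1) 0 hm.le
        have e2 := rivalBudget_strictMono a 0 m (show B i < ((0 : ℕ) + 2) * m by
          push_cast; linarith)
        linarith
    · rw [pay_self, pay_rival, ← hak]
      linarith
  | late b hn hA =>
    subst hn
    push_cast at hbud
    have hc : LateOutcome a b (pay B i (latePrice a (b + 1) (B i) m) i)
        (pay B i (latePrice a (b + 1) (B i) m) (!i)) m z := by
      rw [pay_self, pay_rival]; exact hA
    have e : B i = m + (b + 2) * z := by rw [hbud]; ring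
    have e2 : B i - latePrice a (b + 1) (B i) m = m + (b + 1) * z := by rw [hpz, e]; ring
    rw [roundPrice_of_late (by omega) hW hc hz, pay_self, e2, hpz]
    rw [e] at hpz
    exact (latePrice_eq_of_latePrice_succ_eq h.nonneg hpz).le

theorem roundPrice_mem (hB : Admissible v (k + 1) B) (w : Agent) :
    0 ≤ roundPrice v k B ∧ roundPrice v k B ≤ B w := by
  have key : ∀ i : Agent, ∀ p : ℝ, 0 ≤ p → p ≤ B i → p ≤ B (!i) → roundPrice v k B = p →
      0 ≤ roundPrice v k B ∧ roundPrice v k B ≤ B w := by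
    rintro i p h0 h1 h2 rfl
    exact ⟨h0, forall_agent (P := fun j => _ ≤ B j) i h1 h2 w⟩
  have lop : ∀ i : Agent, (k + 1) * B i < B (!i) →
      0 ≤ roundPrice v k B ∧ roundPrice v k B ≤ B w := by
    intro i h
    have hx := hB.nonneg i
    have : 0 ≤ k * B i := by positivity
    exact key i _ hx le_rfl (by linarith) (roundPrice_of_lopsided hx h).1
  have late : ∀ (i : Agent) (a n : ℕ) (m z : ℝ), a + n + 1 = k →
      LateOutcome a n (B i) (B !i) m z → 0 < z →
      0 ≤ roundPrice v k B ∧ roundPrice v k B ≤ B w := fun i a n m z hk h hz =>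
    key i _ (hz.le.trans h.le_latePrice) (h.latePrice_lt hz).le (h.latePrice_lt_rival hz).le
      (roundPrice_of_late hk hB h hz)
  rcases (add_nonneg (hB.nonneg w) (hB.nonneg !w)).eq_or_lt with h0 | h0
  · have h1 := hB.nonneg w
    have h2 := hB.nonneg !w
    have hz : ∀ i, B i = 0 := forall_agent w (by linarith) (by linarith)
    rw [roundPrice_of_zero hz, hz]
    exact ⟨le_rfl, le_rfl⟩
  rcases exists_strictOutcome_or_contested (k := k + 1) (hB.nonneg w) (hB.nonneg !w) h0 with
    ⟨n, n', m, m', hk, h⟩ | ⟨a, n, hk, h⟩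
  · cases h with
    | poor hn hm hm' h =>
      obtain rfl : n' = k + 1 := by omega
      exact lop w (by push_cast at hm'; linarith)
    | rich hn' hm' hm h =>
      obtain rfl : n = k + 1 := by omega
      exact lop (!w) (by rw [Bool.not_not]; push_cast at hm; linarith)
    | late a b hn hn' h hz => exact late w a b _ _ (by omega) h hz
    | early a b hn hn' h hz => exact late (!w) b a _ _ (by omega) (by simpa using h) hz
  · exact key w _ h.price_nonneg h.price_le h.price_le_rival
      (roundPrice_of_contested (by omega) hB h)

/-- Prices do not increase from one round to the next. -/
theorem roundPrice_pay_le (hB : Admissible v (k + 2) B) {w : Agent}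
    (hw : w ∈ winners (canonicalBids v (utility v (k + 1)) (k + 2) B)) :
    roundPrice v k (pay B w (roundPrice v (k + 1) B)) ≤ roundPrice v (k + 1) B := by
  have lop : ∀ i : Agent, ((k + 1 : ℕ) + 1) * B i < B (!i) →
      roundPrice v k (pay B w (roundPrice v (k + 1) B)) ≤ roundPrice v (k + 1) B := by
    intro i h
    have hx := hB.nonneg i
    obtain ⟨h1, h2⟩ := roundPrice_of_lopsided (v := v) hx h
    rw [h2, Finset.mem_singleton] at hw
    rw [h1, hw, (roundPrice_of_lopsided (i := i) (by simpa using hx) ?_).1, pay_not_self]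
    rw [pay_not_self, pay_self B (!i)]
    push_cast at h
    linarith
  have late : ∀ (i : Agent) (a n : ℕ) (m z : ℝ), a + n + 1 = k + 1 →
      LateOutcome a n (B i) (B !i) m z → 0 < z →
      roundPrice v k (pay B w (roundPrice v (k + 1) B)) ≤ roundPrice v (k + 1) B := by
    intro i a n m z hk h hz
    rw [roundPrice_of_late hk hB h hz]
    obtain ⟨r, hb, hr, hlt⟩ := (utilityDescribed v (k + 1)).canonicalBids_late hk hB h hz
    have hrival := roundPrice_pay_rival_late hk hB h hz
    rcases hlt with hlt | ⟨-, hA, hpz⟩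
    · rw [hb, winners_thresholdBids_of_lt hlt, Finset.mem_singleton] at hw
      rw [hw]
      exact hrival
    · exact forall_agent (P := fun w => roundPrice v k (pay B w _) ≤ _) i
        (roundPrice_pay_late hk hB h hz hA hpz) hrival w
  rcases (add_nonneg (hB.nonneg w) (hB.nonneg !w)).eq_or_lt with h0 | h0
  · have h1 := hB.nonneg w
    have h2 := hB.nonneg !w
    have hz : ∀ i, B i = 0 := forall_agent w (by linarith) (by linarith)
    rw [roundPrice_of_zero hz, roundPrice_of_zero]
    exact forall_agent w (by simp [hz]) (by simp [hz])
  rcases exists_strictOutcome_or_contested (k := k + 2) (hB.nonneg w) (hB.nonneg !w) h0 with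
    ⟨n, n', m, m', hk, h⟩ | ⟨a, n, hk, h⟩
  · cases h with
    | poor hn hm hm' h =>
      obtain rfl : n' = k + 2 := by omega
      exact lop w (by push_cast at hm' ⊢; linarith)
    | rich hn' hm' hm h =>
      obtain rfl : n = k + 2 := by omega
      exact lop (!w) (by rw [Bool.not_not]; push_cast at hm ⊢; linarith)
    | late a b hn hn' h hz => exact late w a b _ _ (by omega) h hz
    | early a b hn hn' h hz => exact late (!w) b a _ _ (by omega) (by simpa using h) hz
  · have h' : Contested n a (B !w) (B !!w) := by simpa using h.symm
    rw [roundPrice_of_contested (i := !w) (by omega) hB h']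
    have := roundPrice_pay_contested (k := k) (by omega) hB h'
    rwa [Bool.not_not] at this ⊢

/-- The bound of all prices by the first one strengthens the induction, so that comparing adjacent
rounds suffices. -/
theorem IsCanonicalPlay.pairwise_and_le {l : List (Agent × ℝ)} (h : IsCanonicalPlay v k B l)
    (hB : Admissible v k B) :
    (l.map Prod.snd).Pairwise (fun earlier later => later ≤ earlier) ∧
      ∀ j, k = j + 1 → ∀ q ∈ l.map Prod.snd, q ≤ roundPrice v j B := by
  induction h with
  | nil B => simp
  | cons k B w p l hw hp hl ih =>
    rw [canonicalBids_amount] at hp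
    subst hp
    have hmem := roundPrice_mem hB w
    obtain ⟨h1, h2⟩ := ih (hB.pay hmem.1 hmem.2)
    have hle : ∀ q ∈ l.map Prod.snd, q ≤ roundPrice v k B := by
      cases k with
      | zero => cases hl; simp
      | succ k => exact fun q hq => (h2 k rfl q hq).trans (roundPrice_pay_le hB hw)
    refine ⟨List.pairwise_cons.2 ⟨hle, h1⟩, fun j hj => ?_⟩
    obtain rfl : k = j := by omega
    simpa using hle

end SeqAuction

theorem mainTheorem4 (k : ℕ) (v B : SeqAuction.Agent → ℝ) (hB : ∀ i, 0 ≤ B i)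
    (hv : ∀ i j, 2 ^ k * B j < v i) :
    (2 ≤ k → ¬ SeqAuction.Lopsided k B → ∀ i,
      ∃! p, SeqAuction.IsCriticalPrice v (SeqAuction.utility v (k - 1)) B i p) ∧
    (∀ l, SeqAuction.IsCanonicalPlay v k B l →
      (l.map Prod.snd).Pairwise (fun earlier later => later ≤ earlier)) := by
  have hadm : SeqAuction.Admissible v k B := fun i => ⟨hB i, hv i i⟩
  refine ⟨fun hk hl i => ?_, fun l hl => (hl.pairwise_and_le hadm).1⟩
  suffices h : ∃ p, SeqAuction.IsCriticalPrice v (SeqAuction.utility v (k - 1)) B i p by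
    obtain ⟨p, hp⟩ := h
    exact ⟨p, hp, fun q hq => hq.unique hp⟩
  obtain ⟨k, rfl⟩ : ∃ j, k = j + 1 := ⟨k - 1, by omega⟩
  rw [SeqAuction.lopsided_iff i, not_or, not_lt, not_lt] at hl
  rcases (hB i).eq_or_lt with h0 | h0
  -- Not being lopsided makes both budgets vanish together, and `0` is then the only affordable
  -- price.
  · have h1 : B (!i) = 0 := le_antisymm (by simpa [← h0] using hl.1) (hB _)
    exact ⟨0, SeqAuction.isCriticalPrice_zero (SeqAuction.forall_agent i h0.symm h1)⟩
  · have h1 : 0 < B (!i) := by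
      rcases (hB (!i)).eq_or_lt with h1 | h1
      · rw [← h1] at hl
        linarith [hl.2]
      · exact h1
    exact (SeqAuction.utilityDescribed v k).exists_isCriticalPrice (by omega) hadm h0 h1
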